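/- Fix an integer $k\ge 2$ and $\delta\in(0,1/k)$. A Markov chain over $[k]=\{1,\dots,k\}$ is given by an initial distribution $\mu$ and a transition matrix $M$. Let $\mathbb{M}^k_\delta$ be the set of all chains with $M_{ij}\ge\delta$ for all $i,j$ ($\mu$ arbitrary), and let $\pi$ denote the stationary distribution of a chain. An estimator $\hat M$ maps every sequence $x^n\in[k]^n$ to a transition matrix $\hat M_{x^n}$ over $[k]\times[k]$. For the loss $L_2(p,q)=\sum_{j}(p_j-q_j)^2$ put $$\varepsilon_n(M,\hat M)=\max_{i\in[k]}\mathbb{E}\big[L_2(M(i,\cdot),\hat M_{X^n}(i,\cdot))\big],\qquad \tilde\varepsilon_n(M,\hat M)=\sum_{i\in[k]}\pi_i\,\mathbb{E}\big[L_2(M(i,\cdot),\hat M_{X^n}(i,\cdot))\big],$$ where $X^n$ is a sample of length $n$ from the chain, and let $\varepsilon_n(\mathbb{M}^k_\delta)=\inf_{\hat M}\sup_{\mathbb{M}^k_\delta}\varepsilon_n(M,\hat M)$ and $\tilde\varepsilon_n(\mathbb{M}^k_\delta)=\inf_{\hat M}\sup_{\mathbb{M}^k_\delta}\tilde\varepsilon_n(M,\hat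 M)$ be the minimax risks. Write $a_n\lesssim b_n$ if $a_n\le b_n(1+o(1))$ as $n\to\infty$ (with $k,\delta$ fixed), and $a_n\asymp b_n$ if $a_n\lesssim b_n$ and $b_n\lesssim a_n$. Then $$\tilde\varepsilon_n(\mathbb{M}^k_\delta)\asymp\frac{k-1}{n}\qquad\text{and}\qquad (1-\delta)^2\,\frac{1-\frac1{k-1}}{n\delta}\lesssim\varepsilon_n(\mathbb{M}^k_\delta)\lesssim\frac{1-\frac1k}{n\delta}.$$ Moreover, both upper bounds are attained by the add-$\sqrt{N_i}/k$ estimator $$\hat M_{x^n}(i,j)=\frac{N_{ij}+\sqrt{N_i}/k}{N_i+\sqrt{N_i}},$$ where $N_{ij}$ is the number of times $j$ appears right after $i$ in $x^n$, $N_i$ is the number of times $i$ appears in $x^{n-1}$, and a row with $N_i=0$ is set to the uniform distribution: its worst-case risks over $\mathbb{M}^k_\delta$ satisfy $\sup_{\mathbb{M}^k_\delta}\tilde\varepsilon_n(M,\hat M)\lesssim\frac{k-1}{n}$ and $\sup_{\mathbb{M}^k_\delta}\varepsilon_n(M,\hat M)\lesssim\frac{1-1/k}{n\delta}$. -/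

import Mathlib

open Filter Topology

/-- A transition matrix over `k` states: every row is a probability distribution. -/
abbrev TransitionMatrix (k : ℕ) : Type := Fin k → stdSimplex ℝ (Fin k)

/-- A (time-homogeneous) Markov chain over `k` states: an initial distribution `μ` and a
transition matrix `M`. -/
structure MarkovChain (k : ℕ) where
  /-- the initial distribution -/
  init : stdSimplex ℝ (Fin k)
  /-- the transition matrix -/
  trans : TransitionMatrix k

/-- The chains all of whose transition probabilities are at least `δ`; the initial distribution
is arbitrary. -/
def chainsAbove (k : ℕ) (δ : ℝ) : Set (MarkovChain k) :=
  {C | ∀ i j, δ ≤ C.trans i j}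

/-- The probability that the first `n` observations of the chain are `x 0, …, x (n - 1)`. -/
noncomputable def MarkovChain.pathProb {k : ℕ} (C : MarkovChain k) :
    {n : ℕ} → (Fin n → Fin k) → ℝ
  | 0, _ => 1
  | m + 1, x => C.init (x 0) * ∏ t : Fin m, C.trans (x t.castSucc) (x t.succ)

/-- `p` is stationary for the transition matrix `M`, that is `p M = p`. -/
def IsStationaryFor {k : ℕ} (M : TransitionMatrix k) (p : stdSimplex ℝ (Fin k)) : Prop :=
  ∀ j, ∑ i, p i * M i j = p j

open Classical in
/-- A stationary distribution `π` of the chain. A chain on a finite nonempty state space has one,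
and it is unique when all transition probabilities are positive. -/
noncomputable def MarkovChain.stationary {k : ℕ} (C : MarkovChain k) : Fin k → ℝ :=
  if h : ∃ p : stdSimplex ℝ (Fin k), IsStationaryFor C.trans p then h.choose else 0

/-- The squared Euclidean loss between two distributions. -/
noncomputable def lossL2 {k : ℕ} (p q : stdSimplex ℝ (Fin k)) : ℝ :=
  ∑ j, (p j - q j) ^ 2

/-- An estimator from samples of length `n`: it maps every sequence to a transition matrix. -/
abbrev Estimator (k n : ℕ) : Type := (Fin n → Fin k) → TransitionMatrix k

/-- The expected loss in row `i`, for a sample of length `n` from the chain `C`. -/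
noncomputable def stateRisk {k n : ℕ} (C : MarkovChain k) (E : Estimator k n) (i : Fin k) : ℝ :=
  ∑ x : Fin n → Fin k, C.pathProb x * lossL2 (C.trans i) (E x i)

/-- The estimation risk: the largest expected loss over the states. -/
noncomputable def maxRisk {k n : ℕ} (C : MarkovChain k) (E : Estimator k n) : ℝ :=
  ⨆ i : Fin k, stateRisk C E i

/-- The alternative estimation risk: the average of the expected losses over the states,
weighted by the stationary distribution. -/
noncomputable def weightedRisk {k n : ℕ} (C : MarkovChain k) (E : Estimator k n) : ℝ :=
  ∑ i : Fin k, C.stationary i * stateRisk C E i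

/-- The worst-case risk of an estimator over a class of chains. (The risks used here take values
in `[0, 2]`, so this is a supremum of a bounded family.) -/
noncomputable def worstCaseRisk {k n : ℕ} (R : MarkovChain k → Estimator k n → ℝ)
    (S : Set (MarkovChain k)) (E : Estimator k n) : ℝ :=
  ⨆ C : S, R C E

/-- The minimax risk over a class of chains, for samples of length `n`. -/
noncomputable def minimaxRisk {k n : ℕ} (R : MarkovChain k → Estimator k n → ℝ)
    (S : Set (MarkovChain k)) : ℝ :=
  ⨅ E : Estimator k n, worstCaseRisk R S E

/-- `N_i`: the number of times `i` appears among the first `n - 1` entries of `x`. -/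
def visits {k : ℕ} : {n : ℕ} → (Fin n → Fin k) → Fin k → ℕ
  | 0, _, _ => 0
  | m + 1, x, i => (Finset.univ.filter fun t : Fin m => x t.castSucc = i).card

/-- `N_ij`: the number of times `j` appears right after `i` in `x`. -/
def transitions {k : ℕ} : {n : ℕ} → (Fin n → Fin k) → Fin k → Fin k → ℕ
  | 0, _, _, _ => 0
  | m + 1, x, i, j =>
    (Finset.univ.filter fun t : Fin m => x t.castSucc = i ∧ x t.succ = j).card

theorem sum_transitions {k n : ℕ} (x : Fin n → Fin k) (i : Fin k) :
    ∑ j, transitions x i j = visits x i := by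
  cases n with
  | zero => simp [transitions, visits]
  | succ m =>
    simp only [transitions, visits]
    rw [Finset.card_eq_sum_card_fiberwise (f := fun t : Fin m => x t.succ)
      (t := Finset.univ) (by intro t _; simp)]
    simp [Finset.filter_filter]

/-- The entries of the estimator obtained by adding `√N_i / k` to every count in row `i`;
a row whose state has not been visited (where the formula reads `0 / 0`) is uniform. -/
noncomputable def addSqrtEntry {k n : ℕ} (x : Fin n → Fin k) (i j : Fin k) : ℝ :=
  if visits x i = 0 then 1 / (k : ℝ)
  else ((transitions x i j : ℝ) + √(visits x i : ℝ) / k) / ((visits x i : ℝ) + √(visits x i : ℝ))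

theorem addSqrtEntry_mem {k n : ℕ} (x : Fin n → Fin k) (i : Fin k) :
    addSqrtEntry x i ∈ stdSimplex ℝ (Fin k) := by
  have hk : (k : ℝ) ≠ 0 := by
    have : 0 < k := i.pos
    positivity
  refine ⟨fun j => ?_, ?_⟩
  · unfold addSqrtEntry
    split_ifs <;> positivity
  · unfold addSqrtEntry
    split_ifs with h
    · simp [hk]
    · have hv : 0 < (visits x i : ℝ) := by exact_mod_cast Nat.pos_of_ne_zero h
      have hs : ∑ j, (transitions x i j : ℝ) = visits x i := by
        exact_mod_cast sum_transitions x i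
      rw [← Finset.sum_div, Finset.sum_add_distrib, hs]
      simp only [Finset.sum_const, Finset.card_univ, Fintype.card_fin, nsmul_eq_mul]
      rw [mul_div_cancel₀ _ hk]
      exact div_self (by positivity)

/-- The add-`√N_i / k` estimator. -/
noncomputable def addSqrtEstimator (k n : ℕ) : Estimator k n :=
  fun x i => ⟨addSqrtEntry x i, addSqrtEntry_mem x i⟩

/-- `a ≲ b`: `a n ≤ b n (1 + o(1))` as `n → ∞`. -/
def AsympLE (a b : ℕ → ℝ) : Prop :=
  ∃ e : ℕ → ℝ, Tendsto e atTop (𝓝 0) ∧ ∀ᶠ n in atTop, a n ≤ b n * (1 + e n)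

/-- `a ≍ b`: both `a ≲ b` and `b ≲ a`. -/
def AsympEq (a b : ℕ → ℝ) : Prop :=
  AsympLE a b ∧ AsympLE b a

/-! Write `p` for row `i` of the transition matrix, `N = N_i`, and `S_j = N_ij - N p_j`. Given the
past, each visit to `i` is followed by a fresh draw from `p`, so `S_j` is a martingale with `E S_j =
0` and `E S_j² = p_j (1 - p_j) E N`.

Upper bounds. The error of the estimator in entry `j` is, up to sign, `(S_j + √N (1/k - p_j)) / (N +
√N)`. If `N` could be treated as a constant, the cross terms would average to zero, and variance and
squared bias would add up to `E N (1 - ∑ p²) + E N (∑ p² - 1/k) = E N (1 - 1/k)`, whatever `p` is.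
Since `N` concentrates around `n π_i`, the risk in row `i` is about `(1 - 1/k) / (n π_i)`, uniformly
over the class. Multiplying by `π_i` and summing gives `(k - 1) / n`; using `π_i ≥ δ` gives the
other bound. Concentration (`IsChainLaw.pathMean_deviation_le`) comes from the Doob martingale of
`N`: because `M ≥ δ`, the expected number of future visits depends on the current state by at most
`1 / δ` over any horizon (`exists_occupation_range`).

Lower bounds. Put independent smooth priors of radius `r` on the free entries of the matrix near a
base chain whose rows are all equal to `q`. The van Trees inequality (`vanTrees_tiltRow`) bounds the
Bayes risk of each entry below through the Fisher information, which is `E N_i` times the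
information of a single draw from row `i`. Fubini adds the entries, and some chain in the box does
at least as badly as the average (`exists_mem_box_sum_le`, `exists_tiltedRows_sum_pathMean_ge`). The
prior contributes only a constant to the information, so `r` may tend to 0 after `n` tends to
infinity. The uniform base chain gives the weighted bound; a base chain entering one state with
probability `δ` gives the bound for the maximum. -/

/-- The weight of a path under the initial weights `q` and the transition weights `M`. -/
noncomputable def pathWeight {k : ℕ} (q : Fin k → ℝ) (M : Fin k → Fin k → ℝ) {m : ℕ}
    (x : Fin (m + 1) → Fin k) : ℝ :=
  q (x 0) * ∏ t : Fin m, M (x t.castSucc) (x t.succ)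

/-- The sum of a function over all paths, weighted by `pathWeight`. -/
noncomputable def pathMean {k : ℕ} (q : Fin k → ℝ) (M : Fin k → Fin k → ℝ) {m : ℕ}
    (F : (Fin (m + 1) → Fin k) → ℝ) : ℝ :=
  ∑ x, pathWeight q M x * F x

/-- `q` is a probability vector and `M` is a row-stochastic matrix. -/
structure IsChainLaw {k : ℕ} (q : Fin k → ℝ) (M : Fin k → Fin k → ℝ) : Prop where
  init_nonneg : ∀ a, 0 ≤ q a
  init_sum : ∑ a, q a = 1
  nonneg : ∀ a b, 0 ≤ M a b
  row_sum : ∀ a, ∑ b, M a b = 1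

/-! ### Expectations over paths -/

section PathMean

variable {k m : ℕ} {q : Fin k → ℝ} {M : Fin k → Fin k → ℝ}

/-- The path `x` followed by the state `y`. -/
abbrev appendState (x : Fin (m + 1) → Fin k) (y : Fin k) : Fin (m + 2) → Fin k :=
  Fin.snoc (α := fun _ => Fin k) x y

theorem pathWeight_appendState (x : Fin (m + 1) → Fin k) (y : Fin k) :
    pathWeight q M (appendState x y) = pathWeight q M x * M (x (Fin.last m)) y := by
  have h0 : appendState x y 0 = x 0 := by
    rw [← Fin.castSucc_zero]
    exact Fin.snoc_castSucc (α := fun _ => Fin k) y x 0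
  have h1 : ∀ t : Fin (m + 1), appendState x y t.castSucc = x t := fun t =>
    Fin.snoc_castSucc (α := fun _ => Fin k) y x t
  have h2 : appendState x y (Fin.last (m + 1)) = y := Fin.snoc_last (α := fun _ => Fin k) y x
  unfold pathWeight
  rw [Fin.prod_univ_castSucc, h0, mul_assoc]
  simp only [h1, Fin.succ_last, h2, Fin.succ_castSucc]

theorem pathMean_zero (F : (Fin 1 → Fin k) → ℝ) :
    pathMean q M F = ∑ a, q a * F (fun _ => a) := by
  unfold pathMean pathWeight
  rw [← (Equiv.funUnique (Fin 1) (Fin k)).symm.sum_comp]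
  refine Finset.sum_congr rfl fun a _ => ?_
  have e : (Equiv.funUnique (Fin 1) (Fin k)).symm a = fun _ => a := by
    funext t
    rw [Subsingleton.elim t default]
    simp
  simp [e]

/-- Conditioning on everything but the last state; the inductions on the sample length below rest on
this identity. -/
theorem pathMean_succ (F : (Fin (m + 2) → Fin k) → ℝ) :
    pathMean q M F =
      pathMean q M fun x => ∑ y, M (x (Fin.last m)) y * F (appendState x y) := by
  unfold pathMean
  rw [← (Fin.snocEquiv (fun _ => Fin k)).sum_comp, Fintype.sum_prod_type, Finset.sum_comm]
  refine Finset.sum_congr rfl fun x _ => ?_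
  rw [Finset.mul_sum]
  refine Finset.sum_congr rfl fun y _ => ?_
  rw [← mul_assoc, ← pathWeight_appendState]
  rfl

theorem pathMean_add (F G : (Fin (m + 1) → Fin k) → ℝ) :
    (pathMean q M fun x => F x + G x) = pathMean q M F + pathMean q M G := by
  simp [pathMean, mul_add, Finset.sum_add_distrib]

theorem pathMean_const_mul (c : ℝ) (F : (Fin (m + 1) → Fin k) → ℝ) :
    (pathMean q M fun x => c * F x) = c * pathMean q M F := by
  simp only [pathMean, Finset.mul_sum]
  exact Finset.sum_congr rfl fun x _ => by ring

theorem pathMean_sum {ι : Type*} (s : Finset ι) (F : ι → (Fin (m + 1) → Fin k) → ℝ) :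
    (pathMean q M fun x => ∑ j ∈ s, F j x) = ∑ j ∈ s, pathMean q M (F j) := by
  simp only [pathMean, Finset.mul_sum]
  exact Finset.sum_comm

namespace IsChainLaw

variable (h : IsChainLaw q M)
include h

theorem pathWeight_nonneg (x : Fin (m + 1) → Fin k) : 0 ≤ pathWeight q M x :=
  mul_nonneg (h.init_nonneg _) (Finset.prod_nonneg fun _ _ => h.nonneg _ _)

theorem pathMean_mono {F G : (Fin (m + 1) → Fin k) → ℝ} (hFG : ∀ x, F x ≤ G x) :
    pathMean q M F ≤ pathMean q M G :=
  Finset.sum_le_sum fun x _ => mul_le_mul_of_nonneg_left (hFG x) (h.pathWeight_nonneg x)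

theorem pathMean_nonneg {F : (Fin (m + 1) → Fin k) → ℝ} (hF : ∀ x, 0 ≤ F x) :
    0 ≤ pathMean q M F :=
  Finset.sum_nonneg fun x _ => mul_nonneg (h.pathWeight_nonneg x) (hF x)

theorem pathMean_const (c : ℝ) : (pathMean q M fun _ : Fin (m + 1) → Fin k => c) = c := by
  induction m with
  | zero => rw [pathMean_zero, ← Finset.sum_mul, h.init_sum, one_mul]
  | succ m ih =>
    rw [pathMean_succ]
    simp only [← Finset.sum_mul, h.row_sum, one_mul]
    exact ih

end IsChainLaw

end PathMean

/-! ### Visit and transition counts -/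

section Counts

variable {k m : ℕ}

theorem visits_single (x : Fin 1 → Fin k) (i : Fin k) : visits x i = 0 := by
  simp [visits]

theorem transitions_single (x : Fin 1 → Fin k) (i j : Fin k) : transitions x i j = 0 := by
  simp [transitions]

theorem visits_appendState (x : Fin (m + 1) → Fin k) (y i : Fin k) :
    (visits (appendState x y) i : ℝ) = visits x i + if x (Fin.last m) = i then 1 else 0 := by
  have h1 : ∀ t : Fin (m + 1), appendState x y t.castSucc = x t := fun t =>
    Fin.snoc_castSucc (α := fun _ => Fin k) y x t
  simp only [visits, Finset.card_filter, Fin.sum_univ_castSucc, h1]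
  push_cast
  rfl

theorem transitions_appendState (x : Fin (m + 1) → Fin k) (y i j : Fin k) :
    (transitions (appendState x y) i j : ℝ) =
      transitions x i j + if x (Fin.last m) = i ∧ y = j then 1 else 0 := by
  have h1 : ∀ t : Fin (m + 1), appendState x y t.castSucc = x t := fun t =>
    Fin.snoc_castSucc (α := fun _ => Fin k) y x t
  have h2 : appendState x y (Fin.last (m + 1)) = y := Fin.snoc_last (α := fun _ => Fin k) y x
  simp only [transitions, Finset.card_filter, Fin.sum_univ_castSucc, h1, h2, Fin.succ_castSucc,
    Fin.succ_last]
  push_cast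
  rfl

/-- The sum of `g` over the states that follow a visit to `i`. -/
noncomputable def rowScore (i : Fin k) (g : Fin k → ℝ) {n : ℕ} (x : Fin n → Fin k) : ℝ :=
  ∑ l, (transitions x i l : ℝ) * g l

theorem rowScore_appendState (x : Fin (m + 1) → Fin k) (y i : Fin k) (g : Fin k → ℝ) :
    rowScore i g (appendState x y) =
      rowScore i g x + if x (Fin.last m) = i then g y else 0 := by
  simp only [rowScore, transitions_appendState, add_mul, Finset.sum_add_distrib]
  congr 1
  by_cases hx : x (Fin.last m) = i <;> simp [hx]

end Counts

/-! ### Martingale moments of the counts -/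

section Moments

variable {k m : ℕ} {q : Fin k → ℝ} {M : Fin k → Fin k → ℝ} {i : Fin k}

/-- The score is a martingale: its increment vanishes unless the current state is `i`, and then it
is `g` of a draw from row `i`, centred by `hg`. -/
theorem IsChainLaw.pathMean_rowScore (h : IsChainLaw q M) {g : Fin k → ℝ}
    (hg : ∑ l, M i l * g l = 0) :
    (pathMean q M fun x : Fin (m + 1) → Fin k => rowScore i g x) = 0 := by
  induction m with
  | zero => simp [pathMean_zero, rowScore, transitions_single]
  | succ m ih =>
    rw [pathMean_succ, ← ih]
    congr 1
    funext x
    simp only [rowScore_appendState, mul_add, Finset.sum_add_distrib, ← Finset.sum_mul,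
      h.row_sum, one_mul]
    by_cases hx : x (Fin.last m) = i <;> simp [hx, hg]

/-- Martingale increments are orthogonal, and every visit to `i` adds the same conditional variance.
This serves twice: as the variance of the transition counts and as the Fisher information of a path.
-/
theorem IsChainLaw.pathMean_rowScore_sq (h : IsChainLaw q M) {g : Fin k → ℝ}
    (hg : ∑ l, M i l * g l = 0) :
    (pathMean q M fun x : Fin (m + 1) → Fin k => rowScore i g x ^ 2) =
      (pathMean q M fun x : Fin (m + 1) → Fin k => (visits x i : ℝ)) * ∑ l, M i l * g l ^ 2 := by
  induction m with
  | zero => simp [pathMean_zero, rowScore, transitions_single, visits_single]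
  | succ m ih =>
    rw [pathMean_succ, pathMean_succ]
    have e1 : ∀ x : Fin (m + 1) → Fin k,
        ∑ y, M (x (Fin.last m)) y * rowScore i g (appendState x y) ^ 2 =
          rowScore i g x ^ 2 +
            (∑ l, M i l * g l ^ 2) * if x (Fin.last m) = i then 1 else 0 := by
      intro x
      by_cases hx : x (Fin.last m) = i
      · simp only [rowScore_appendState, hx, if_true, mul_one]
        have : ∀ y, M i y * (rowScore i g x + g y) ^ 2 = M i y * rowScore i g x ^ 2 +
            2 * rowScore i g x * (M i y * g y) + M i y * g y ^ 2 := fun y => by ring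
        simp only [this, Finset.sum_add_distrib, ← Finset.sum_mul, ← Finset.mul_sum, hg,
          h.row_sum]
        ring
      · simp [rowScore_appendState, hx, ← Finset.sum_mul, h.row_sum]
    have e2 : ∀ x : Fin (m + 1) → Fin k,
        ∑ y, M (x (Fin.last m)) y * (visits (appendState x y) i : ℝ) =
          visits x i + if x (Fin.last m) = i then 1 else 0 := by
      intro x
      simp only [visits_appendState, ← Finset.sum_mul, h.row_sum, one_mul]
    simp only [e1, e2, pathMean_add, pathMean_const_mul, ih]
    ring

/-- Each of the `m` counted states equals `i` with probability at most `β`. For the lower bounds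
this crude estimate suffices, since there column `i` is nearly constant. -/
theorem IsChainLaw.pathMean_visits_le (h : IsChainLaw q M) {β : ℝ} (hq : q i ≤ β)
    (hM : ∀ a, M a i ≤ β) :
    (pathMean q M fun x : Fin (m + 1) → Fin k => (visits x i : ℝ)) ≤ m * β := by
  have last_le : ∀ m : ℕ, (pathMean q M fun x : Fin (m + 1) → Fin k =>
      if x (Fin.last m) = i then (1 : ℝ) else 0) ≤ β := by
    intro m
    cases m with
    | zero => simpa [pathMean_zero] using hq
    | succ m =>
      have h2 : ∀ (x : Fin (m + 1) → Fin k) y, appendState x y (Fin.last (m + 1)) = y :=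
        fun x y => Fin.snoc_last (α := fun _ => Fin k) y x
      rw [pathMean_succ]
      simp only [h2, mul_ite, mul_one, mul_zero, Finset.sum_ite_eq', Finset.mem_univ, if_true]
      calc _ ≤ pathMean q M fun _ : Fin (m + 1) → Fin k => β := h.pathMean_mono fun x => hM _
        _ = β := h.pathMean_const β
  induction m with
  | zero => simp [pathMean_zero, visits_single]
  | succ m ih =>
    rw [pathMean_succ]
    simp only [visits_appendState, ← Finset.sum_mul, h.row_sum, one_mul, pathMean_add]
    push_cast
    linarith [last_le m]

end Moments

/-! ### Concentration of the number of visits -/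

section Occupation

variable {k m : ℕ} {q : Fin k → ℝ} {M : Fin k → Fin k → ℝ} {i : Fin k}

/-- The expected number of visits to `i` among the first `t` states of a path that starts
at `a`. -/
noncomputable def occupation (M : Fin k → Fin k → ℝ) (i : Fin k) : ℕ → Fin k → ℝ
  | 0, _ => 0
  | t + 1, a => (if a = i then 1 else 0) + ∑ b, M a b * occupation M i t b

/-- Past visits plus expected future visits form the Doob martingale. `visits` omits the last state
while `occupation` counts its starting state, so nothing is counted twice. -/
theorem IsChainLaw.pathMean_visits_add_occupation (h : IsChainLaw q M) (t : ℕ) :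
    (pathMean q M fun x : Fin (m + 1) → Fin k =>
      (visits x i : ℝ) + occupation M i t (x (Fin.last m))) =
      ∑ a, q a * occupation M i (t + m) a := by
  induction m generalizing t with
  | zero => simp [pathMean_zero, visits_single]
  | succ m ih =>
    have h2 : ∀ (x : Fin (m + 1) → Fin k) y, appendState x y (Fin.last (m + 1)) = y :=
      fun x y => Fin.snoc_last (α := fun _ => Fin k) y x
    rw [pathMean_succ, show t + (m + 1) = t + 1 + m by ring, ← ih (t + 1)]
    congr 1
    funext x
    simp only [visits_appendState, h2, mul_add, Finset.sum_add_distrib, ← Finset.sum_mul,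
      h.row_sum, one_mul, occupation]
    ring

/-- A Doeblin minorisation: splitting `M a b = δ + (M a b - δ)`, the first part contributes the same
amount for every `a`. The remainder has mass `1 - k δ`, so it shrinks an oscillation `1 / δ` to `1 /
δ - k`, which leaves room for the indicator of the current visit. -/
theorem exists_occupation_range (hM : ∀ a, ∑ b, M a b = 1) {δ : ℝ} (hδ : 0 < δ)
    (hMδ : ∀ a b, δ ≤ M a b) (i : Fin k) (t : ℕ) :
    ∃ lo, ∀ a, lo ≤ occupation M i t a ∧ occupation M i t a ≤ lo + 1 / δ := by
  induction t with
  | zero => exact ⟨0, fun a => by simp [occupation, hδ.le]⟩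
  | succ t ih =>
    obtain ⟨lo, hlo⟩ := ih
    set D : Fin k → ℝ := fun b => occupation M i t b - lo with hD
    have hD0 : ∀ b, 0 ≤ D b := fun b => by simp only [hD]; linarith [(hlo b).1]
    have hD1 : ∀ b, D b ≤ 1 / δ := fun b => by simp only [hD]; linarith [(hlo b).2]
    refine ⟨lo + δ * ∑ b, D b, fun a => ?_⟩
    have hk : (1 : ℝ) ≤ k := by exact_mod_cast i.pos
    have e : ∑ b, M a b * occupation M i t b = lo + δ * ∑ b, D b + ∑ b, (M a b - δ) * D b := by
      have : ∀ b, M a b * occupation M i t b = M a b * lo + (δ * D b + (M a b - δ) * D b) :=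
        fun b => by simp only [hD]; ring
      simp only [this, Finset.sum_add_distrib, ← Finset.sum_mul, hM, ← Finset.mul_sum]
      ring
    have lower : 0 ≤ ∑ b, (M a b - δ) * D b :=
      Finset.sum_nonneg fun b _ => mul_nonneg (by linarith [hMδ a b]) (hD0 b)
    have upper : ∑ b, (M a b - δ) * D b ≤ 1 / δ - 1 := by
      calc ∑ b, (M a b - δ) * D b ≤ ∑ b, (M a b - δ) * (1 / δ) :=
            Finset.sum_le_sum fun b _ =>
              mul_le_mul_of_nonneg_left (hD1 b) (by linarith [hMδ a b])
        _ = 1 / δ - k := by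
            rw [← Finset.sum_mul, Finset.sum_sub_distrib, hM]
            simp only [Finset.sum_const, Finset.card_univ, Fintype.card_fin, nsmul_eq_mul]
            field_simp
        _ ≤ _ := by linarith
    simp only [occupation, e]
    split_ifs <;> constructor <;> linarith

/-- A Hoeffding-type bound with a crude constant, obtained from `exp y ≤ 1 + y + y²` for `|y| ≤ 1`
applied to the centred variable. -/
theorem sum_mul_exp_le {p U : Fin k → ℝ} (hp : ∀ b, 0 ≤ p b) (hp1 : ∑ b, p b = 1) {lo c s : ℝ}
    (hU : ∀ b, lo ≤ U b ∧ U b ≤ lo + c) (hs : |s| * c ≤ 1) :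
    ∑ b, p b * Real.exp (s * U b) ≤ Real.exp (s ^ 2 * c ^ 2 + s * ∑ b, p b * U b) := by
  set μ := ∑ b, p b * U b with hμ
  have hμ1 : lo ≤ μ := by
    calc lo = ∑ b, p b * lo := by rw [← Finset.sum_mul, hp1, one_mul]
      _ ≤ μ := Finset.sum_le_sum fun b _ => mul_le_mul_of_nonneg_left (hU b).1 (hp b)
  have hμ2 : μ ≤ lo + c := by
    calc μ ≤ ∑ b, p b * (lo + c) :=
          Finset.sum_le_sum fun b _ => mul_le_mul_of_nonneg_left (hU b).2 (hp b)
      _ = lo + c := by rw [← Finset.sum_mul, hp1, one_mul]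
  have key : ∀ b, Real.exp (s * (U b - μ)) ≤ 1 + s * (U b - μ) + s ^ 2 * c ^ 2 := by
    intro b
    have hc : |U b - μ| ≤ c := abs_le.2 ⟨by linarith [(hU b).1], by linarith [(hU b).2]⟩
    have habs : |s * (U b - μ)| ≤ |s| * c := by
      rw [abs_mul]; exact mul_le_mul_of_nonneg_left hc (abs_nonneg s)
    have h1 := (abs_le.1 (Real.abs_exp_sub_one_sub_id_le (habs.trans hs))).2
    have h2 : (s * (U b - μ)) ^ 2 ≤ s ^ 2 * c ^ 2 := by
      rw [mul_pow]
      exact mul_le_mul_of_nonneg_left (sq_le_sq' (abs_le.1 hc).1 (abs_le.1 hc).2) (sq_nonneg s)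
    linarith
  calc ∑ b, p b * Real.exp (s * U b)
      = Real.exp (s * μ) * ∑ b, p b * Real.exp (s * (U b - μ)) := by
        rw [Finset.mul_sum]
        refine Finset.sum_congr rfl fun b _ => ?_
        rw [mul_left_comm, ← Real.exp_add]
        congr 2; ring
    _ ≤ Real.exp (s * μ) * ∑ b, p b * (1 + s * (U b - μ) + s ^ 2 * c ^ 2) := by
        gcongr with b _
        · exact hp b
        · exact key b
    _ = Real.exp (s * μ) * (s ^ 2 * c ^ 2 + 1) := by
        congr 1
        have : ∀ b, p b * (1 + s * (U b - μ) + s ^ 2 * c ^ 2) =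
            p b * (1 - s * μ + s ^ 2 * c ^ 2) + s * (p b * U b) := fun b => by ring
        simp only [this, Finset.sum_add_distrib, ← Finset.sum_mul, ← Finset.mul_sum, hp1, ← hμ]
        ring
    _ ≤ Real.exp (s * μ) * Real.exp (s ^ 2 * c ^ 2) := by
        gcongr
        exact Real.add_one_le_exp _
    _ = _ := by rw [← Real.exp_add]; congr 1; ring

/-- Azuma's argument for the Doob martingale: averaging out the last state lengthens the horizon
from `t` to `t + 1` and costs one factor `exp (s² / δ²)`. -/
theorem IsChainLaw.pathMean_exp_le (h : IsChainLaw q M) {δ : ℝ} (hδ : 0 < δ)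
    (hMδ : ∀ a b, δ ≤ M a b) {s : ℝ} (hs : |s| * (1 / δ) ≤ 1) (t : ℕ) :
    (pathMean q M fun x : Fin (m + 1) → Fin k =>
      Real.exp (s * (visits x i + occupation M i t (x (Fin.last m))))) ≤
      Real.exp (m * (s ^ 2 * (1 / δ) ^ 2)) *
        ∑ a, q a * Real.exp (s * occupation M i (t + m) a) := by
  induction m generalizing t with
  | zero => simp [pathMean_zero, visits_single]
  | succ m ih =>
    have h2 : ∀ (x : Fin (m + 1) → Fin k) y, appendState x y (Fin.last (m + 1)) = y :=
      fun x y => Fin.snoc_last (α := fun _ => Fin k) y x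
    obtain ⟨lo, hlo⟩ := exists_occupation_range h.row_sum hδ hMδ i t
    rw [pathMean_succ]
    calc _ ≤ pathMean q M fun x : Fin (m + 1) → Fin k => Real.exp (s ^ 2 * (1 / δ) ^ 2) *
          Real.exp (s * (visits x i + occupation M i (t + 1) (x (Fin.last m)))) := by
          refine h.pathMean_mono fun x => ?_
          set a := x (Fin.last m)
          have := sum_mul_exp_le (h.nonneg a) (h.row_sum a) hlo hs
          simp only [visits_appendState, h2]
          calc _ = Real.exp (s * (visits x i + if a = i then 1 else 0)) *
                ∑ y, M a y * Real.exp (s * occupation M i t y) := by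
                rw [Finset.mul_sum]
                refine Finset.sum_congr rfl fun y _ => ?_
                rw [mul_left_comm, ← Real.exp_add, mul_add]
            _ ≤ _ := mul_le_mul_of_nonneg_left this (Real.exp_pos _).le
            _ = _ := by
                rw [← Real.exp_add, ← Real.exp_add]
                simp only [occupation]
                congr 1; ring
      _ ≤ _ := by
          rw [pathMean_const_mul]
          refine (mul_le_mul_of_nonneg_left (ih (t + 1)) (Real.exp_pos _).le).trans_eq ?_
          rw [← mul_assoc, ← Real.exp_add, ← add_assoc, add_right_comm]
          congr 2
          push_cast; ring

variable {p : Fin k → ℝ}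

/-- Under the stationary law the mean occupation is exactly `t * p i`, so this number lies in the
same interval of length `1 / δ` as all the values. -/
theorem abs_occupation_sub_le (hM : ∀ a, ∑ b, M a b = 1) {δ : ℝ} (hδ : 0 < δ)
    (hMδ : ∀ a b, δ ≤ M a b) (hp : ∀ a, 0 ≤ p a) (hp1 : ∑ a, p a = 1)
    (hpM : ∀ b, ∑ a, p a * M a b = p b) (t : ℕ) (a : Fin k) :
    |occupation M i t a - t * p i| ≤ 1 / δ := by
  have mean : ∀ t : ℕ, ∑ a, p a * occupation M i t a = t * p i := by
    intro t
    induction t with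
    | zero => simp [occupation]
    | succ t ih =>
      simp only [occupation, mul_add, Finset.sum_add_distrib, Finset.mul_sum]
      rw [Finset.sum_comm]
      simp only [← mul_assoc, ← Finset.sum_mul, hpM, ih]
      simp
      ring
  obtain ⟨lo, hlo⟩ := exists_occupation_range hM hδ hMδ i t
  have h1 : lo ≤ t * p i := by
    rw [← mean]
    calc lo = ∑ b, p b * lo := by rw [← Finset.sum_mul, hp1, one_mul]
      _ ≤ _ := Finset.sum_le_sum fun b _ => mul_le_mul_of_nonneg_left (hlo b).1 (hp b)
  have h2 : t * p i ≤ lo + 1 / δ := by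
    rw [← mean]
    calc _ ≤ ∑ b, p b * (lo + 1 / δ) :=
          Finset.sum_le_sum fun b _ => mul_le_mul_of_nonneg_left (hlo b).2 (hp b)
      _ = lo + 1 / δ := by rw [← Finset.sum_mul, hp1, one_mul]
  exact abs_le.2 ⟨by linarith [(hlo a).1], by linarith [(hlo a).2]⟩

/-- The mean number of visits is within `1 / δ` of its stationary value. -/
theorem IsChainLaw.pathMean_visits_le_stationary (h : IsChainLaw q M) {δ : ℝ} (hδ : 0 < δ)
    (hMδ : ∀ a b, δ ≤ M a b) (hp : ∀ a, 0 ≤ p a) (hp1 : ∑ a, p a = 1)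
    (hpM : ∀ b, ∑ a, p a * M a b = p b) :
    (pathMean q M fun x : Fin (m + 1) → Fin k => (visits x i : ℝ)) ≤ m * p i + 1 / δ := by
  have := h.pathMean_visits_add_occupation (m := m) (i := i) 0
  simp only [occupation, add_zero, zero_add] at this
  rw [this]
  calc _ ≤ ∑ a, q a * (m * p i + 1 / δ) := Finset.sum_le_sum fun a _ =>
        mul_le_mul_of_nonneg_left (by
          linarith [(abs_le.1 (abs_occupation_sub_le h.row_sum hδ hMδ hp hp1 hpM m a (i := i))).2])
          (h.init_nonneg a)
    _ = _ := by rw [← Finset.sum_mul, h.init_sum, one_mul]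

theorem IsChainLaw.pathMean_exp_visits_le (h : IsChainLaw q M) {δ : ℝ} (hδ : 0 < δ)
    (hMδ : ∀ a b, δ ≤ M a b) (hp : ∀ a, 0 ≤ p a) (hp1 : ∑ a, p a = 1)
    (hpM : ∀ b, ∑ a, p a * M a b = p b) {s : ℝ} (hs : |s| * (1 / δ) ≤ 1) :
    (pathMean q M fun x : Fin (m + 1) → Fin k => Real.exp (s * (visits x i - m * p i))) ≤
      Real.exp (m * (s ^ 2 * (1 / δ) ^ 2) + 1) := by
  have key := h.pathMean_exp_le (m := m) (i := i) hδ hMδ hs 0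
  simp only [occupation, add_zero, zero_add] at key
  have split : ∀ x : Fin (m + 1) → Fin k, Real.exp (s * (visits x i - m * p i)) =
      Real.exp (-(s * (m * p i))) * Real.exp (s * visits x i) := fun x => by
    rw [← Real.exp_add]; congr 1; ring
  simp only [split, pathMean_const_mul]
  have hsum : ∑ a, q a * Real.exp (s * occupation M i m a) ≤ Real.exp (s * (m * p i) + 1) := by
    calc _ ≤ ∑ a, q a * Real.exp (s * (m * p i) + 1) := by
          refine Finset.sum_le_sum fun a _ => mul_le_mul_of_nonneg_left ?_ (h.init_nonneg a)
          refine Real.exp_le_exp.2 ?_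
          have h1 := abs_occupation_sub_le h.row_sum hδ hMδ hp hp1 hpM m a (i := i)
          have h2 : |s * (occupation M i m a - m * p i)| ≤ 1 := by
            rw [abs_mul]
            exact (mul_le_mul_of_nonneg_left h1 (abs_nonneg s)).trans hs
          nlinarith [(abs_le.1 h2).2]
      _ = _ := by rw [← Finset.sum_mul, h.init_sum, one_mul]
  calc _ ≤ Real.exp (-(s * (m * p i))) * (Real.exp (m * (s ^ 2 * (1 / δ) ^ 2)) *
        Real.exp (s * (m * p i) + 1)) := by
        refine mul_le_mul_of_nonneg_left (key.trans ?_) (Real.exp_pos _).le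
        exact mul_le_mul_of_nonneg_left hsum (Real.exp_pos _).le
    _ = _ := by rw [← Real.exp_add, ← Real.exp_add]; congr 1; ring

/-- Two-sided concentration of the number of visits around its stationary value. -/
theorem IsChainLaw.pathMean_deviation_le (h : IsChainLaw q M) {δ : ℝ} (hδ : 0 < δ)
    (hMδ : ∀ a b, δ ≤ M a b) (hp : ∀ a, 0 ≤ p a) (hp1 : ∑ a, p a = 1)
    (hpM : ∀ b, ∑ a, p a * M a b = p b) {η : ℝ} (hη : 0 < η) (hηδ : η * δ ≤ 2) :
    (pathMean q M fun x : Fin (m + 1) → Fin k =>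
      if |(visits x i : ℝ) - m * p i| ≤ η * m then (0 : ℝ) else 1) ≤
      2 * Real.exp (1 - m * (η ^ 2 * δ ^ 2 / 4)) := by
  -- The minimiser of the Chernoff exponent `s² / δ² - s η`; the condition `η δ ≤ 2` keeps `|s| / δ
  -- ≤ 1`.
  set s : ℝ := η * δ ^ 2 / 2 with hsdef
  have hs0 : 0 < s := by positivity
  have hs : |s| * (1 / δ) ≤ 1 := by
    rw [abs_of_pos hs0, hsdef]
    field_simp
    linarith
  have hs' : |(-s)| * (1 / δ) ≤ 1 := by rwa [abs_neg]
  have h1 := h.pathMean_exp_visits_le (m := m) (i := i) hδ hMδ hp hp1 hpM hs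
  have h2 := h.pathMean_exp_visits_le (m := m) (i := i) hδ hMδ hp hp1 hpM hs'
  rw [neg_sq] at h2
  have bound : ∀ x : Fin (m + 1) → Fin k,
      (if |(visits x i : ℝ) - m * p i| ≤ η * m then (0 : ℝ) else 1) ≤
        Real.exp (-(s * (η * m))) * (Real.exp (s * (visits x i - m * p i)) +
          Real.exp (-s * (visits x i - m * p i))) := by
    intro x
    split_ifs with hx
    · positivity
    · rw [mul_add, ← Real.exp_add, ← Real.exp_add]
      push Not at hx
      rcases lt_abs.1 hx with hx | hx
      · have : 1 ≤ Real.exp (-(s * (η * m)) + s * (visits x i - m * p i)) :=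
          Real.one_le_exp (by nlinarith)
        linarith [Real.exp_pos (-(s * (η * m)) + -s * (visits x i - m * p i))]
      · have : 1 ≤ Real.exp (-(s * (η * m)) + -s * (visits x i - m * p i)) :=
          Real.one_le_exp (by nlinarith)
        linarith [Real.exp_pos (-(s * (η * m)) + s * (visits x i - m * p i))]
  calc _ ≤ _ := h.pathMean_mono bound
    _ ≤ Real.exp (-(s * (η * m))) * (Real.exp (m * (s ^ 2 * (1 / δ) ^ 2) + 1) +
          Real.exp (m * (s ^ 2 * (1 / δ) ^ 2) + 1)) := by
        rw [pathMean_const_mul, pathMean_add]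
        exact mul_le_mul_of_nonneg_left (add_le_add h1 h2) (Real.exp_pos _).le
    _ = 2 * (Real.exp (-(s * (η * m))) * Real.exp (m * (s ^ 2 * (1 / δ) ^ 2) + 1)) := by ring
    _ = _ := by
        rw [← Real.exp_add]
        congr 2
        rw [hsdef]
        field_simp
        ring

end Occupation

/-! ### Stationary distributions -/

section Chain

variable {k : ℕ}

theorem stdSimplex_sum (p : stdSimplex ℝ (Fin k)) : ∑ j, p j = 1 := p.2.2

theorem stdSimplex_nonneg (p : stdSimplex ℝ (Fin k)) (j : Fin k) : 0 ≤ p j := p.2.1 j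

theorem stdSimplex_le_one (p : stdSimplex ℝ (Fin k)) (j : Fin k) : p j ≤ 1 := by
  rw [← stdSimplex_sum p]
  exact Finset.single_le_sum (fun l _ => stdSimplex_nonneg p l) (Finset.mem_univ j)

theorem MarkovChain.isChainLaw (C : MarkovChain k) :
    IsChainLaw (fun a => C.init a) (fun a b => C.trans a b) where
  init_nonneg := stdSimplex_nonneg _
  init_sum := stdSimplex_sum _
  nonneg _ := stdSimplex_nonneg _
  row_sum _ := stdSimplex_sum _

theorem stateRisk_eq_pathMean {m : ℕ} (C : MarkovChain k) (E : Estimator k (m + 1)) (i : Fin k) :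
    stateRisk C E i = pathMean (fun a => C.init a) (fun a b => C.trans a b)
      fun x => lossL2 (C.trans i) (E x i) := rfl

/-- The all-ones vector makes `A - 1` singular, hence there is a left fixed vector `v`. By the
triangle inequality `|v| ≤ |v| A` entrywise, and both sides have the same total, so `|v|` is fixed
as well. -/
theorem exists_stationary (M : TransitionMatrix k) (hk : 0 < k) :
    ∃ p : stdSimplex ℝ (Fin k), IsStationaryFor M p := by
  have : Nonempty (Fin k) := ⟨⟨0, hk⟩⟩
  let A : Matrix (Fin k) (Fin k) ℝ := Matrix.of fun i j => M i j
  have hdet : (A - 1).det = 0 := by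
    refine Matrix.exists_mulVec_eq_zero_iff.1 ⟨1, one_ne_zero, ?_⟩
    rw [Matrix.sub_mulVec, Matrix.one_mulVec, sub_eq_zero]
    funext i
    simp [Matrix.mulVec, dotProduct, A]
  obtain ⟨v, hv0, hv⟩ := Matrix.exists_vecMul_eq_zero_iff.2 hdet
  rw [Matrix.vecMul_sub, Matrix.vecMul_one, sub_eq_zero] at hv
  have hv' : ∀ j, ∑ i, v i * M i j = v j := fun j => by
    simpa [Matrix.vecMul, dotProduct, A] using congrFun hv j
  have hle : ∀ j ∈ Finset.univ, |v j| ≤ ∑ i, |v i| * M i j := fun j _ => by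
    rw [← hv' j]
    refine (Finset.abs_sum_le_sum_abs _ _).trans_eq (Finset.sum_congr rfl fun i _ => ?_)
    rw [abs_mul, abs_of_nonneg (stdSimplex_nonneg (M i) j)]
  have htot : ∑ j, |v j| = ∑ j, ∑ i, |v i| * M i j := by
    rw [Finset.sum_comm]
    simp only [← Finset.mul_sum, stdSimplex_sum, mul_one]
  have heq := (Finset.sum_eq_sum_iff_of_le hle).1 htot
  have hpos : 0 < ∑ j, |v j| := by
    obtain ⟨j, hj⟩ := Function.ne_iff.1 hv0
    exact Finset.sum_pos' (fun j _ => abs_nonneg _) ⟨j, Finset.mem_univ j, abs_pos.2 hj⟩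
  refine ⟨⟨fun j => |v j| / ∑ l, |v l|, fun j => by positivity, ?_⟩, fun j => ?_⟩
  · rw [← Finset.sum_div, div_self hpos.ne']
  · change ∑ i, |v i| / (∑ l, |v l|) * M i j = |v j| / ∑ l, |v l|
    rw [heq j (Finset.mem_univ j), Finset.sum_div]
    exact Finset.sum_congr rfl fun i _ => by ring

theorem MarkovChain.stationary_spec (C : MarkovChain k) (hk : 0 < k) :
    (∀ a, 0 ≤ C.stationary a) ∧ ∑ a, C.stationary a = 1 ∧
      ∀ b, ∑ a, C.stationary a * C.trans a b = C.stationary b := by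
  have h := exists_stationary C.trans hk
  have e : C.stationary = h.choose := by
    unfold MarkovChain.stationary
    rw [dif_pos h]
  rw [e]
  exact ⟨stdSimplex_nonneg _, stdSimplex_sum _, h.choose_spec⟩

theorem MarkovChain.le_stationary (C : MarkovChain k) {δ : ℝ} {j : Fin k}
    (hC : ∀ i, δ ≤ C.trans i j) : δ ≤ C.stationary j := by
  obtain ⟨h0, h1, h2⟩ := C.stationary_spec j.pos
  rw [← h2]
  calc δ = ∑ a, C.stationary a * δ := by rw [← Finset.sum_mul, h1, one_mul]
    _ ≤ _ := Finset.sum_le_sum fun a _ => mul_le_mul_of_nonneg_left (hC a) (h0 a)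

end Chain

/-! ### Pathwise bounds for the loss of the estimator -/

section Loss

variable {k : ℕ}

theorem lossL2_nonneg (p q : stdSimplex ℝ (Fin k)) : 0 ≤ lossL2 p q :=
  Finset.sum_nonneg fun _ _ => sq_nonneg _

theorem lossL2_le_two (p q : stdSimplex ℝ (Fin k)) : lossL2 p q ≤ 2 := by
  calc lossL2 p q ≤ ∑ j, (p j + q j) := Finset.sum_le_sum fun j _ => by
        nlinarith [stdSimplex_nonneg p j, stdSimplex_nonneg q j, stdSimplex_le_one p j,
          stdSimplex_le_one q j, mul_nonneg (stdSimplex_nonneg p j) (stdSimplex_nonneg q j)]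
    _ = 2 := by rw [Finset.sum_add_distrib, stdSimplex_sum, stdSimplex_sum]; norm_num

theorem rowScore_indicator_sub {n : ℕ} (x : Fin n → Fin k) (i j : Fin k) (c : ℝ) :
    rowScore i (fun l => (if l = j then 1 else 0) - c) x =
      transitions x i j - visits x i * c := by
  have : ∑ l, (transitions x i l : ℝ) = visits x i := by exact_mod_cast sum_transitions x i
  simp [rowScore, mul_sub, Finset.sum_sub_distrib, ← Finset.sum_mul, this]

/-- A polynomial in the centred transition counts out of state `i` that dominates the loss of the
add-`√N_i / k` estimator, up to normalisation, when the number of visits is close to `μ`. -/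
noncomputable def lossMajorant (p : stdSimplex ℝ (Fin k)) (i : Fin k) (μ ε : ℝ) {n : ℕ}
    (x : Fin n → Fin k) : ℝ :=
  ∑ j, ((1 + ε) * rowScore i (fun l => (if l = j then 1 else 0) - p j) x ^ 2 +
    (1 / (k : ℝ) - p j) ^ 2 * ((visits x i : ℝ) + ε * μ) +
    2 * √μ * (1 / (k : ℝ) - p j) * rowScore i (fun l => (if l = j then 1 else 0) - p j) x)

/-- The squared bias towards the uniform distribution. Added to the variance `1 - ∑ p²` it gives `1
- 1/k`, free of `p`. -/
theorem sum_sq_uniform_sub (p : stdSimplex ℝ (Fin k)) :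
    ∑ j, (1 / (k : ℝ) - p j) ^ 2 = ∑ j, p j ^ 2 - 1 / k := by
  have hk : (k : ℝ) ≠ 0 := by
    rintro hk
    have : k = 0 := by exact_mod_cast hk
    subst this
    simpa using stdSimplex_sum p
  have : ∀ j, (1 / (k : ℝ) - p j) ^ 2 = 1 / (k : ℝ) ^ 2 - 2 / k * p j + p j ^ 2 := fun j => by
    field_simp
    ring
  simp only [this, Finset.sum_add_distrib, Finset.sum_sub_distrib, ← Finset.mul_sum,
    stdSimplex_sum, Finset.sum_const, Finset.card_univ, Fintype.card_fin, nsmul_eq_mul]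
  field_simp
  ring

/-- Completing the square in `S + √μ (1/k - p j)`: the majorant can be negative, because its cross
term carries `√μ` instead of `√N`, but not by more than `μ`. -/
theorem neg_le_lossMajorant (p : stdSimplex ℝ (Fin k)) (i : Fin k) {μ ε : ℝ} (hμ : 0 ≤ μ)
    (hε : 0 ≤ ε) {n : ℕ} (x : Fin n → Fin k) : -μ ≤ lossMajorant p i μ ε x := by
  have hs : ∑ j, (1 / (k : ℝ) - p j) ^ 2 ≤ 1 := by
    rw [sum_sq_uniform_sub]
    have : ∑ j, p j ^ 2 ≤ ∑ j, p j := Finset.sum_le_sum fun j _ => by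
      nlinarith [stdSimplex_nonneg p j, stdSimplex_le_one p j]
    rw [stdSimplex_sum] at this
    have : 0 ≤ 1 / (k : ℝ) := by positivity
    linarith
  calc -μ ≤ ∑ j, -(μ * (1 / (k : ℝ) - p j) ^ 2) := by
        rw [Finset.sum_neg_distrib, ← Finset.mul_sum]
        nlinarith
    _ ≤ _ := by
        refine Finset.sum_le_sum fun j _ => ?_
        set S := rowScore i (fun l => (if l = j then 1 else 0) - p j) x
        set a := 1 / (k : ℝ) - p j
        have h1 : 0 ≤ a ^ 2 * ((visits x i : ℝ) + ε * μ) := by positivity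
        have h2 : 0 ≤ ε * S ^ 2 := by positivity
        have h3 : √μ * √μ = μ := Real.mul_self_sqrt hμ
        nlinarith [sq_nonneg (S + √μ * a)]

/-- Replacing `√N` by `√μ` in the cross term makes that term linear in the martingale `S`, hence of
mean zero. The replacement costs at most `ε (S² + μ a²)` by the arithmetic-geometric mean
inequality. -/
theorem lossL2_addSqrt_le_majorant (p : stdSimplex ℝ (Fin k)) (i : Fin k) {μ ε : ℝ} (hμ : 1 ≤ μ)
    (hε : 0 ≤ ε) (hε' : ε ≤ 1 / 2) {n : ℕ} (x : Fin n → Fin k)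
    (hN : |(visits x i : ℝ) - μ| ≤ ε * μ) :
    lossL2 p (addSqrtEstimator k n x i) ≤ lossMajorant p i μ ε x / ((1 - ε) * μ) ^ 2 := by
  have hNlo : (1 - ε) * μ ≤ visits x i := by nlinarith [(abs_le.1 hN).1]
  have hpos : 0 < (1 - ε) * μ := by nlinarith
  have hN0 : (0 : ℝ) < visits x i := hpos.trans_le hNlo
  have hv : visits x i ≠ 0 := by
    have : 0 < visits x i := by exact_mod_cast hN0
    omega
  have hk : (k : ℝ) ≠ 0 := by
    have : 0 < k := i.pos
    positivity
  set N : ℝ := (visits x i : ℝ) with hNdef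
  have hroot : |√N - √μ| ≤ ε * √μ := by
    have hs : √μ * √μ = μ := Real.mul_self_sqrt (by linarith)
    have hsN : √N * √N = N := Real.mul_self_sqrt hN0.le
    have hsμ : 0 < √μ := Real.sqrt_pos.2 (by linarith)
    have e : |√N - √μ| * (√N + √μ) = |N - μ| := by
      rw [← abs_of_nonneg (show 0 ≤ √N + √μ by positivity), ← abs_mul]
      congr 1
      linarith [show (√N - √μ) * (√N + √μ) = √N * √N - √μ * √μ by ring]
    have h1 : |√N - √μ| * √μ ≤ |N - μ| := by
      rw [← e]
      exact mul_le_mul_of_nonneg_left (by linarith [Real.sqrt_nonneg N]) (abs_nonneg _)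
    have h2 : |√N - √μ| * √μ ≤ (ε * √μ) * √μ := by
      rw [mul_assoc, hs]; exact h1.trans hN
    exact le_of_mul_le_mul_right h2 hsμ
  unfold lossL2 lossMajorant
  rw [Finset.sum_div]
  refine Finset.sum_le_sum fun j _ => ?_
  set S := rowScore i (fun l => (if l = j then 1 else 0) - p j) x with hS
  rw [rowScore_indicator_sub] at hS
  set a := 1 / (k : ℝ) - p j with ha
  have hval : p j - addSqrtEstimator k n x i j = -(S + √N * a) / (N + √N) := by
    change p j - addSqrtEntry x i j = _
    unfold addSqrtEntry
    rw [if_neg hv, hS, ha, ← hNdef]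
    have : N + √N ≠ 0 := by positivity
    field_simp
    ring
  have hnum : (S + √N * a) ^ 2 ≤ (1 + ε) * S ^ 2 + a ^ 2 * (N + ε * μ) + 2 * √μ * a * S := by
    have hsN : √N ^ 2 = N := Real.sq_sqrt hN0.le
    have hsμ : √μ ^ 2 = μ := Real.sq_sqrt (by linarith)
    have h1 : 2 * (√N - √μ) * (a * S) ≤ ε * (S ^ 2 + μ * a ^ 2) := by
      calc 2 * (√N - √μ) * (a * S) ≤ |2 * (√N - √μ) * (a * S)| := le_abs_self _
        _ = 2 * |√N - √μ| * |a * S| := by rw [abs_mul, abs_mul, abs_two]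
        _ ≤ 2 * (ε * √μ) * |a * S| := by gcongr
        _ = ε * (2 * (√μ * |a|) * |S|) := by rw [abs_mul]; ring
        _ ≤ ε * ((√μ * |a|) ^ 2 + |S| ^ 2) :=
            mul_le_mul_of_nonneg_left (two_mul_le_add_sq _ _) hε
        _ = _ := by rw [mul_pow, hsμ, sq_abs, sq_abs]; ring
    nlinarith
  rw [hval, div_pow, neg_sq]
  calc (S + √N * a) ^ 2 / (N + √N) ^ 2 ≤ (S + √N * a) ^ 2 / ((1 - ε) * μ) ^ 2 := by
        gcongr
        linarith [Real.sqrt_nonneg N]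
    _ ≤ _ := by gcongr

/-- A bound on every path allows the exact moments of the majorant to be used without conditioning
on a good event. On the bad event the loss is at most 2 and the scaled majorant at least `-4`,
whence the 6. -/
theorem lossL2_addSqrt_le (p : stdSimplex ℝ (Fin k)) (i : Fin k) {μ ε : ℝ} (hμ : 1 ≤ μ)
    (hε : 0 ≤ ε) (hε' : ε ≤ 1 / 2) {n : ℕ} (x : Fin n → Fin k) :
    lossL2 p (addSqrtEstimator k n x i) ≤ 1 / ((1 - ε) * μ) ^ 2 * lossMajorant p i μ ε x +
      6 * if |(visits x i : ℝ) - μ| ≤ ε * μ then 0 else 1 := by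
  split_ifs with hN
  · have := lossL2_addSqrt_le_majorant p i hμ hε hε' x hN
    rw [mul_zero, add_zero, one_div_mul_eq_div]
    exact this
  · have h1 := lossL2_le_two p (addSqrtEstimator k n x i)
    have h2 := neg_le_lossMajorant p i (by linarith : 0 ≤ μ) hε x
    have h3 : -4 ≤ 1 / ((1 - ε) * μ) ^ 2 * lossMajorant p i μ ε x := by
      have hpos : 0 < (1 - ε) * μ := by nlinarith
      rw [one_div_mul_eq_div, le_div_iff₀ (by positivity)]
      have : 1 / 2 * μ ≤ (1 - ε) * μ := by nlinarith
      have : (1 / 2 * μ) ^ 2 ≤ ((1 - ε) * μ) ^ 2 := by gcongr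
      nlinarith
    linarith

end Loss

/-! ### Risk of the estimator in one state -/

section UpperBound

variable {k m : ℕ}

theorem pathMean_lossMajorant (C : MarkovChain k) (i : Fin k) (μ ε : ℝ) :
    (pathMean (fun a => C.init a) (fun a b => C.trans a b)
      fun x : Fin (m + 1) → Fin k => lossMajorant (C.trans i) i μ ε x) =
    (1 + ε) * (pathMean (fun a => C.init a) (fun a b => C.trans a b)
      fun x : Fin (m + 1) → Fin k => (visits x i : ℝ)) * (1 - ∑ j, C.trans i j ^ 2) +
    ((pathMean (fun a => C.init a) (fun a b => C.trans a b)
      fun x : Fin (m + 1) → Fin k => (visits x i : ℝ)) + ε * μ) *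
      (∑ j, C.trans i j ^ 2 - 1 / k) := by
  have h := C.isChainLaw
  have hg : ∀ j, ∑ l, C.trans i l * ((if l = j then (1 : ℝ) else 0) - C.trans i j) = 0 := by
    intro j
    simp [mul_sub, Finset.sum_sub_distrib, ← Finset.sum_mul]
  have hg2 : ∀ j, ∑ l, C.trans i l * ((if l = j then (1 : ℝ) else 0) - C.trans i j) ^ 2 =
      C.trans i j - C.trans i j ^ 2 := by
    intro j
    have : ∀ l, C.trans i l * ((if l = j then (1 : ℝ) else 0) - C.trans i j) ^ 2 =
        C.trans i l * (if l = j then (1 - 2 * C.trans i j) else 0) +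
          C.trans i l * C.trans i j ^ 2 := fun l => by split_ifs <;> ring
    simp only [this, Finset.sum_add_distrib, ← Finset.sum_mul, stdSimplex_sum]
    simp
    ring
  have c := h.pathMean_const (m := m) (ε * μ)
  unfold lossMajorant
  simp only [pathMean_sum, pathMean_add, pathMean_const_mul, h.pathMean_rowScore (hg _),
    h.pathMean_rowScore_sq (hg _), hg2, c, mul_zero, Finset.sum_const_zero, Finset.sum_add_distrib,
    ← Finset.mul_sum, ← Finset.sum_mul, Finset.sum_sub_distrib, stdSimplex_sum,
    sum_sq_uniform_sub]
  ring

theorem stateRisk_addSqrt_le {δ : ℝ} (hδ : 0 < δ) {C : MarkovChain k} (hC : C ∈ chainsAbove k δ)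
    (i : Fin k) {ε : ℝ} (hε : 0 < ε) (hε' : ε ≤ 1 / 2) (hm : 1 ≤ m * δ) :
    stateRisk C (addSqrtEstimator k (m + 1)) i ≤
      (1 + ε) * (m * C.stationary i + 1 / δ) * (1 - 1 / k) /
        ((1 - ε) * (m * C.stationary i)) ^ 2 +
      12 * Real.exp (1 - m * ((ε * δ) ^ 2 * δ ^ 2 / 4)) := by
  obtain ⟨h0, h1, h2⟩ := C.stationary_spec i.pos
  have h := C.isChainLaw
  have hπ : δ ≤ C.stationary i := C.le_stationary fun a => hC a i
  set μ : ℝ := m * C.stationary i with hμdef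
  have hμδ : m * δ ≤ μ := mul_le_mul_of_nonneg_left hπ m.cast_nonneg
  have hμ : 1 ≤ μ := hm.trans hμδ
  have hδ1 : δ ≤ 1 := (hC i i).trans (stdSimplex_le_one _ _)
  have hEN := h.pathMean_visits_le_stationary (m := m) (i := i) hδ hC h0 h1 h2
  -- Since `μ ≥ m δ`, a deviation of at most `ε δ m` is at most `ε μ`; this makes the exponential
  -- rate the same for all chains.
  have hdev := h.pathMean_deviation_le (m := m) (i := i) hδ hC h0 h1 h2 (η := ε * δ)
    (by positivity) (by nlinarith [mul_le_mul hδ1 hδ1 hδ.le zero_le_one])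
  rw [← hμdef] at hEN hdev
  set EN := pathMean (fun a => C.init a) (fun a b => C.trans a b)
    fun x : Fin (m + 1) → Fin k => (visits x i : ℝ) with hENdef
  have hsq : ∑ j, C.trans i j ^ 2 ≤ 1 := by
    calc ∑ j, C.trans i j ^ 2 ≤ ∑ j, C.trans i j := Finset.sum_le_sum fun j _ => by
          nlinarith [stdSimplex_nonneg (C.trans i) j, stdSimplex_le_one (C.trans i) j]
      _ = 1 := stdSimplex_sum _
  have hsq' : 0 ≤ ∑ j, C.trans i j ^ 2 - 1 / k := by
    rw [← sum_sq_uniform_sub]; positivity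
  -- The weights `1 - ∑ p²` and `∑ p² - 1/k` are nonnegative with sum `1 - 1/k`, and both
  -- coefficients have the same upper bound.
  have hmaj : (1 + ε) * EN * (1 - ∑ j, C.trans i j ^ 2) +
      (EN + ε * μ) * (∑ j, C.trans i j ^ 2 - 1 / k) ≤
      (1 + ε) * (μ + 1 / δ) * (1 - 1 / k) := by
    have e1 : (1 + ε) * EN ≤ (1 + ε) * (μ + 1 / δ) := by gcongr
    have e2 : EN + ε * μ ≤ (1 + ε) * (μ + 1 / δ) := by
      have : 0 ≤ ε * (1 / δ) := by positivity
      linarith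
    nlinarith [mul_le_mul_of_nonneg_right e1 (sub_nonneg.2 hsq),
      mul_le_mul_of_nonneg_right e2 hsq']
  rw [stateRisk_eq_pathMean]
  calc _ ≤ pathMean (fun a => C.init a) (fun a b => C.trans a b) fun x : Fin (m + 1) → Fin k =>
        1 / ((1 - ε) * μ) ^ 2 * lossMajorant (C.trans i) i μ ε x +
          6 * if |(visits x i : ℝ) - μ| ≤ ε * δ * m then 0 else 1 := by
        refine h.pathMean_mono fun x => (lossL2_addSqrt_le _ i hμ hε.le hε' x).trans ?_
        have hle : ε * δ * m ≤ ε * μ := by nlinarith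
        gcongr
        by_cases hx : |(visits x i : ℝ) - μ| ≤ ε * δ * m
        · rw [if_pos hx, if_pos (hx.trans hle)]
        · rw [if_neg hx]
          split_ifs <;> norm_num
    _ = 1 / ((1 - ε) * μ) ^ 2 * ((1 + ε) * EN * (1 - ∑ j, C.trans i j ^ 2) +
          (EN + ε * μ) * (∑ j, C.trans i j ^ 2 - 1 / k)) + 6 * pathMean (fun a => C.init a)
          (fun a b => C.trans a b) fun x : Fin (m + 1) → Fin k =>
          if |(visits x i : ℝ) - μ| ≤ ε * δ * m then 0 else 1 := by
        rw [pathMean_add, pathMean_const_mul, pathMean_const_mul, pathMean_lossMajorant]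
    _ ≤ 1 / ((1 - ε) * μ) ^ 2 * ((1 + ε) * (μ + 1 / δ) * (1 - 1 / k)) +
          6 * (2 * Real.exp (1 - m * ((ε * δ) ^ 2 * δ ^ 2 / 4))) := by gcongr
    _ = _ := by ring

/-- The risk of the add-`√N_i / k` estimator in state `i` is asymptotically at most
`(1 - 1 / k) / (n π_i)`, uniformly over the class of chains. -/
theorem eventually_stationary_mul_stateRisk_le (hk : 2 ≤ k) {δ : ℝ} (hδ : 0 < δ) {ε : ℝ}
    (hε : 0 < ε) : ∀ᶠ n : ℕ in atTop, ∀ C ∈ chainsAbove k δ, ∀ i,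
      C.stationary i * stateRisk C (addSqrtEstimator k n) i ≤
        (1 - 1 / (k : ℝ)) / n * (1 + ε) := by
  have hk2 : (2 : ℝ) ≤ k := by exact_mod_cast hk
  set κ : ℝ := 1 - 1 / (k : ℝ) with hκdef
  have hκ : 0 < κ := by
    rw [hκdef, sub_pos, div_lt_one (by linarith)]; linarith
  obtain ⟨η, hη0, hη1, hη⟩ : ∃ η : ℝ, 0 < η ∧ η ≤ 1 / 2 ∧ (1 + η) / (1 - η) ^ 2 < 1 + ε := by
    have hc : Tendsto (fun η : ℝ => (1 + η) / (1 - η) ^ 2) (𝓝[>] 0) (𝓝 1) := by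
      have : ContinuousAt (fun η : ℝ => (1 + η) / (1 - η) ^ 2) 0 := by
        refine ContinuousAt.div (by fun_prop) (by fun_prop) (by norm_num)
      simpa using this.tendsto.mono_left nhdsWithin_le_nhds
    have h1 := hc.eventually_lt_const (show (1 : ℝ) < 1 + ε by linarith)
    have h2 : ∀ᶠ η : ℝ in 𝓝[>] 0, η ∈ Set.Ioc (0 : ℝ) (1 / 2) :=
      Ioc_mem_nhdsGT (by norm_num)
    obtain ⟨η, h⟩ := (h1.and h2).exists
    exact ⟨η, h.2.1, h.2.2, h.1⟩
  set b : ℝ := (η * δ) ^ 2 * δ ^ 2 / 4 with hb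
  have hb0 : 0 < b := by positivity
  have lim : Tendsto (fun m : ℕ => ((m : ℝ) + 1) * (κ * (1 + η) / (1 - η) ^ 2 *
      (1 + 1 / δ / (m * δ)) * (1 / m) + 12 * Real.exp (1 - m * b))) atTop
      (𝓝 (κ * ((1 + η) / (1 - η) ^ 2))) := by
    have hn : Tendsto (fun m : ℕ => (m : ℝ)) atTop atTop := tendsto_natCast_atTop_atTop
    have t1 : Tendsto (fun m : ℕ => 1 / (m : ℝ)) atTop (𝓝 0) :=
      tendsto_const_nhds.div_atTop hn
    have t2 : Tendsto (fun m : ℕ => (m : ℝ) * Real.exp (-(b * m))) atTop (𝓝 0) := by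
      have := (tendsto_id.atTop_mul_const hb0).comp hn
      have h3 := (Real.tendsto_pow_mul_exp_neg_atTop_nhds_zero 1).comp this
      have h4 := h3.const_mul (1 / b)
      rw [mul_zero] at h4
      refine h4.congr fun m => ?_
      simp only [Function.comp_apply, id, pow_one]
      rw [mul_comm (m : ℝ) b]
      field_simp
    have t3 : Tendsto (fun m : ℕ => Real.exp (-(b * m))) atTop (𝓝 0) :=
      Real.tendsto_exp_neg_atTop_nhds_zero.comp (hn.const_mul_atTop hb0)
    have main : Tendsto (fun m : ℕ => κ * (1 + η) / (1 - η) ^ 2 *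
        (1 + 1 / δ / δ * (1 / (m : ℝ))) * (1 + 1 / (m : ℝ)) +
        12 * Real.exp 1 * (m * Real.exp (-(b * m)) + Real.exp (-(b * m)))) atTop
        (𝓝 (κ * (1 + η) / (1 - η) ^ 2 * (1 + 1 / δ / δ * 0) * (1 + 0) +
          12 * Real.exp 1 * (0 + 0))) :=
      (((t1.const_mul _).const_add 1).const_mul _).mul (t1.const_add 1) |>.add
        ((t2.add t3).const_mul _)
    rw [show κ * (1 + η) / (1 - η) ^ 2 * (1 + 1 / δ / δ * 0) * (1 + 0) +
      12 * Real.exp 1 * (0 + 0) = κ * ((1 + η) / (1 - η) ^ 2) by ring] at main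
    refine main.congr' ?_
    filter_upwards [eventually_gt_atTop 0] with m hm
    have hm' : (m : ℝ) ≠ 0 := by positivity
    have hη' : 1 - η ≠ 0 := by linarith
    rw [show 1 - m * b = 1 + -(b * m) by ring, Real.exp_add]
    field_simp
  have ev := lim.eventually_lt_const (mul_lt_mul_of_pos_left hη hκ)
  have evm : ∀ᶠ m : ℕ in atTop, 1 ≤ m * δ := by
    have := (tendsto_natCast_atTop_atTop (R := ℝ)).atTop_mul_const hδ
    exact this.eventually_ge_atTop 1
  -- A sample of length `n = m + 1` has `m` transitions.
  rw [← map_add_atTop_eq_nat 1, eventually_map]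
  filter_upwards [ev, evm] with m hm1 hm2 C hC i
  have hπ : δ ≤ C.stationary i := C.le_stationary fun a => hC a i
  obtain ⟨h0, h1, h2⟩ := C.stationary_spec i.pos
  have hπ1 : C.stationary i ≤ 1 := by
    rw [← h1]
    exact Finset.single_le_sum (fun a _ => h0 a) (Finset.mem_univ i)
  have hm0 : (0 : ℝ) < m := pos_of_mul_pos_left (zero_lt_one.trans_le hm2) hδ.le
  have hrisk := stateRisk_addSqrt_le hδ hC i hη0 hη1 hm2
  set π := C.stationary i
  have hπ0 : 0 < π := hδ.trans_le hπ
  have hη' : 0 < 1 - η := by linarith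
  push_cast
  rw [div_mul_eq_mul_div, le_div_iff₀ (by positivity), mul_comm]
  refine le_trans (mul_le_mul_of_nonneg_left ?_ (by positivity)) hm1.le
  calc π * stateRisk C (addSqrtEstimator k (m + 1)) i
      ≤ π * ((1 + η) * (m * π + 1 / δ) * κ / ((1 - η) * (m * π)) ^ 2 +
          12 * Real.exp (1 - m * b)) := mul_le_mul_of_nonneg_left hrisk hπ0.le
    _ = κ * (1 + η) / (1 - η) ^ 2 * (1 + 1 / δ / (m * π)) * (1 / m) +
          π * (12 * Real.exp (1 - m * b)) := by
        field_simp
    _ ≤ κ * (1 + η) / (1 - η) ^ 2 * (1 + 1 / δ / (m * δ)) * (1 / m) +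
          1 * (12 * Real.exp (1 - m * b)) := by gcongr
    _ = _ := by ring

end UpperBound

/-! ### The score of a one-parameter family of chains -/

section PathDerivative

variable {k m : ℕ}

theorem rowScore_eq_sum (i : Fin k) (g : Fin k → ℝ) (x : Fin (m + 1) → Fin k) :
    rowScore i g x = ∑ t : Fin m, if x t.castSucc = i then g (x t.succ) else 0 := by
  simp only [rowScore, transitions, Finset.card_filter, Nat.cast_sum, Finset.sum_mul]
  rw [Finset.sum_comm]
  refine Finset.sum_congr rfl fun t _ => ?_
  by_cases h : x t.castSucc = i <;> simp [h]

/-- The matrix `B` with `t • d` added to its row `i`. -/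
def tiltRow (B : Fin k → Fin k → ℝ) (i : Fin k) (d : Fin k → ℝ) (t : ℝ) (a b : Fin k) : ℝ :=
  B a b + t * if a = i then d b else 0

variable {q : Fin k → ℝ} {B : Fin k → Fin k → ℝ} {i : Fin k} {d : Fin k → ℝ}

theorem contDiff_pathWeight_tiltRow (x : Fin (m + 1) → Fin k) :
    ContDiff ℝ 1 fun t => pathWeight q (tiltRow B i d t) x := by
  unfold pathWeight tiltRow
  exact contDiff_const.mul (contDiff_prod fun s _ => by fun_prop)

/-- The logarithmic derivative of a path's likelihood is a sum over the transitions out of `i`, that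
is, a `rowScore`; it is centred when `d` sums to zero. -/
theorem hasDerivAt_pathWeight_tiltRow {t : ℝ} (ht : ∀ a b, 0 < tiltRow B i d t a b)
    (x : Fin (m + 1) → Fin k) :
    HasDerivAt (fun t => pathWeight q (tiltRow B i d t) x)
      (pathWeight q (tiltRow B i d t) x * rowScore i (fun l => d l / tiltRow B i d t i l) x) t := by
  have h1 : ∀ s ∈ (Finset.univ : Finset (Fin m)),
      HasDerivAt (fun t => tiltRow B i d t (x s.castSucc) (x s.succ))
        (if x s.castSucc = i then d (x s.succ) else 0) t := fun s _ => by
    simpa [tiltRow] using ((hasDerivAt_id t).mul_const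
      (if x s.castSucc = i then d (x s.succ) else 0)).const_add (B (x s.castSucc) (x s.succ))
  have h2 := (HasDerivAt.fun_finsetProd h1).const_mul (q (x 0))
  refine h2.congr_deriv ?_
  rw [rowScore_eq_sum, pathWeight, mul_assoc]
  congr 1
  rw [Finset.mul_sum]
  refine Finset.sum_congr rfl fun s hs => ?_
  rw [← Finset.mul_prod_erase _ _ hs, smul_eq_mul]
  by_cases hi : x s.castSucc = i
  · have := (ht i (x s.succ)).ne'
    simp only [hi, if_true]
    field_simp
  · simp [hi]

end PathDerivative

/-! ### The van Trees inequality -/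

section OneParameter

/-- The density `15 / (16 r ^ 5) * (r ^ 2 - t ^ 2) ^ 2` on `[-r, r]`. -/
noncomputable def bump (r t : ℝ) : ℝ := 15 / (16 * r ^ 5) * (r ^ 2 - t ^ 2) ^ 2

theorem continuous_bump (r : ℝ) : Continuous (bump r) := by unfold bump; fun_prop

theorem bump_nonneg {r : ℝ} (hr : 0 < r) (t : ℝ) : 0 ≤ bump r t := by unfold bump; positivity

theorem hasDerivAt_bump (r t : ℝ) :
    HasDerivAt (bump r) (15 / (16 * r ^ 5) * (-4 * t * (r ^ 2 - t ^ 2))) t := by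
  have h := ((((hasDerivAt_id t).pow 2).const_sub (r ^ 2)).pow 2).const_mul (15 / (16 * r ^ 5))
  refine h.congr_deriv ?_
  simp only [Pi.pow_apply, id]
  push_cast
  ring

/-- A primitive of `bump r`. -/
noncomputable def bumpPrimitive (r t : ℝ) : ℝ :=
  15 / (16 * r ^ 5) * (r ^ 4 * t - 2 * r ^ 2 / 3 * t ^ 3 + 1 / 5 * t ^ 5)

theorem hasDerivAt_bumpPrimitive (r t : ℝ) : HasDerivAt (bumpPrimitive r) (bump r t) t := by
  have h := ((((hasDerivAt_id t).const_mul (r ^ 4)).sub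
    (((hasDerivAt_id t).pow 3).const_mul (2 * r ^ 2 / 3))).add
    (((hasDerivAt_id t).pow 5).const_mul (1 / 5))).const_mul (15 / (16 * r ^ 5))
  refine h.congr_deriv ?_
  simp only [id, bump]
  push_cast
  ring

theorem bumpPrimitive_sub {r : ℝ} (hr : 0 < r) : bumpPrimitive r r - bumpPrimitive r (-r) = 1 := by
  unfold bumpPrimitive
  field_simp
  ring

theorem integral_bump {r : ℝ} (hr : 0 < r) : ∫ t in -r..r, bump r t = 1 := by
  rw [intervalIntegral.integral_eq_sub_of_hasDerivAt
    (fun t _ => hasDerivAt_bumpPrimitive r t) ((continuous_bump r).intervalIntegrable _ _),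
    bumpPrimitive_sub hr]

variable {k m : ℕ} {q : Fin k → ℝ} {B : Fin k → Fin k → ℝ} {i : Fin k} {d : Fin k → ℝ}

/-- A Bayesian Cramér–Rao (van Trees) bound for estimating the entry `(i, j)` of the transition
matrix along a one-parameter family, under the prior density `bump r`. -/
theorem vanTrees_tiltRow {r : ℝ} (hr : 0 < r)
    (hlaw : ∀ t ∈ Set.Icc (-r) r, IsChainLaw q (tiltRow B i d t))
    (hpos : ∀ t ∈ Set.Icc (-r) r, ∀ a b, 0 < tiltRow B i d t a b)
    (hd : ∑ l, d l = 0) {V F : ℝ} (hV0 : 0 ≤ V)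
    (hV : ∀ t ∈ Set.Icc (-r) r, (pathMean q (tiltRow B i d t)
      fun x : Fin (m + 1) → Fin k => (visits x i : ℝ)) ≤ V)
    (hF : ∀ t ∈ Set.Icc (-r) r, ∑ l, d l ^ 2 / tiltRow B i d t i l ≤ F)
    (e : (Fin (m + 1) → Fin k) → ℝ) (j : Fin k) (lam : ℝ) :
    2 * lam * d j - lam ^ 2 * (V * F + 10 / r ^ 2) ≤
      ∫ t in -r..r, bump r t *
        pathMean q (tiltRow B i d t) fun x => (e x - tiltRow B i d t i j) ^ 2 := by
  set c : ℝ := 15 / (16 * r ^ 5) with hc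
  have hc0 : 0 < c := by positivity
  set M := tiltRow B i d with hM
  have hMd : ∀ (x : Fin (m + 1) → Fin k) t, HasDerivAt (fun t => e x - M t i j) (-d j) t :=
    fun x t => by
      simpa [hM, tiltRow] using
        (((hasDerivAt_id t).mul_const (d j)).const_add (B i j)).const_sub (e x)
  have hMc : ContDiff ℝ 1 fun t => M t i j := by
    simp only [hM, tiltRow]; fun_prop
  have hbc : ContDiff ℝ 1 (bump r) := by unfold bump; fun_prop
  -- The derivative of `H` lies below the integrand on `[-r, r]`. Its first term carries out the
  -- integration by parts of van Trees and vanishes at `±r` with `bump r`.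
  set H : ℝ → ℝ := fun t =>
    2 * lam * (∑ x : Fin (m + 1) → Fin k, (e x - M t i j) * pathWeight q (M t) x * bump r t) +
      ((2 * lam * d j - lam ^ 2 * (V * F)) * bumpPrimitive r t -
        lam ^ 2 * (16 * c / 3 * t ^ 3)) with hH
  have hHc : ContDiff ℝ 1 H := by
    refine (contDiff_const.mul (ContDiff.sum fun x _ => ((contDiff_const.sub hMc).mul
      (contDiff_pathWeight_tiltRow x)).mul hbc)).add ?_
    unfold bumpPrimitive
    fun_prop
  have hval : H r - H (-r) = 2 * lam * d j - lam ^ 2 * (V * F + 10 / r ^ 2) := by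
    have hb1 : bump r r = 0 := by simp [bump]
    have hb2 : bump r (-r) = 0 := by simp [bump]
    simp only [hH, hb1, hb2, mul_zero, Finset.sum_const_zero, zero_add]
    have hp := bumpPrimitive_sub hr
    have hcr : c * r ^ 3 = 15 / (16 * r ^ 2) := by rw [hc]; field_simp
    -- The Fisher information of the prior: `bump' ² / bump = 16 c t²` is a polynomial, with
    -- integral `32 c r³ / 3` over `[-r, r]`.
    have h10 : 10 / r ^ 2 = 32 / 3 * (c * r ^ 3) := by rw [hcr]; field_simp; norm_num
    rw [h10]
    linear_combination (2 * lam * d j - lam ^ 2 * (V * F)) * hp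
  rw [← hval, ← intervalIntegral.integral_deriv_eq_sub
    (fun t _ => (hHc.differentiable one_ne_zero) t)
    ((hHc.continuous_deriv le_rfl).intervalIntegrable _ _)]
  refine intervalIntegral.integral_mono_on (by linarith)
    ((hHc.continuous_deriv le_rfl).intervalIntegrable _ _) ?_ fun t ht => ?_
  · refine Continuous.intervalIntegrable ?_ _ _
    refine hbc.continuous.mul ?_
    unfold pathMean
    exact continuous_finsetSum _ fun x _ => (contDiff_pathWeight_tiltRow x).continuous.mul
      ((continuous_const.sub hMc.continuous).pow 2)
  have law := hlaw t ht
  have hMpos := hpos t ht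
  set u : ℝ := r ^ 2 - t ^ 2 with hu
  set s : (Fin (m + 1) → Fin k) → ℝ := fun x => rowScore i (fun l => d l / M t i l) x with hs
  have hderiv : deriv H t = 2 * lam * (∑ x : Fin (m + 1) → Fin k, ((-d j * pathWeight q (M t) x +
      (e x - M t i j) * (pathWeight q (M t) x * s x)) * (c * u ^ 2) +
      (e x - M t i j) * pathWeight q (M t) x * (c * (-4 * t * u)))) +
      ((2 * lam * d j - lam ^ 2 * (V * F)) * (c * u ^ 2) - lam ^ 2 * (16 * c * t ^ 2)) := by
    refine HasDerivAt.deriv ?_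
    refine ((HasDerivAt.fun_sum fun x _ => ((hMd x t).mul
      (hasDerivAt_pathWeight_tiltRow hMpos x)).mul (hasDerivAt_bump r t)).const_mul _).add
      (((hasDerivAt_bumpPrimitive r t).const_mul _).sub ?_)
    have h3 := ((((hasDerivAt_id t).pow 3).const_mul (16 * c / 3)).const_mul (lam ^ 2))
    refine h3.congr_deriv ?_
    simp only [id]
    push_cast
    ring
  have hscore : ∑ l, M t i l * (d l / M t i l) = 0 := by
    rw [← hd]
    exact Finset.sum_congr rfl fun l _ => mul_div_cancel₀ _ (hMpos i l).ne'
  have hs1 : pathMean q (M t) s = 0 := law.pathMean_rowScore hscore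
  have hs2 : (pathMean q (M t) fun x => s x ^ 2) ≤ V * F := by
    rw [hs, law.pathMean_rowScore_sq hscore]
    have hFe : ∑ l, M t i l * (d l / M t i l) ^ 2 = ∑ l, d l ^ 2 / M t i l :=
      Finset.sum_congr rfl fun l _ => by
        have := (hMpos i l).ne'
        field_simp
    rw [hFe]
    refine mul_le_mul (hV t ht) (hF t ht) ?_ hV0
    exact Finset.sum_nonneg fun l _ => div_nonneg (sq_nonneg _) (hMpos i l).le
  -- Cauchy–Schwarz with an explicit multiplier: `c u (s u - 4 t)` is the score of likelihood and
  -- prior together, times `bump`, and no division by `bump` is needed.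
  have hsq : 0 ≤ pathMean q (M t) fun x => ((e x - M t i j) * u - lam * (s x * u - 4 * t)) ^ 2 :=
    law.pathMean_nonneg fun x => sq_nonneg _
  have hexp : (pathMean q (M t) fun x => ((e x - M t i j) * u - lam * (s x * u - 4 * t)) ^ 2) =
      u ^ 2 * (pathMean q (M t) fun x => (e x - M t i j) ^ 2) -
      2 * lam * (u ^ 2 * (pathMean q (M t) fun x => (e x - M t i j) * s x) -
        4 * t * u * (pathMean q (M t) fun x => e x - M t i j)) +
      lam ^ 2 * (u ^ 2 * (pathMean q (M t) fun x => s x ^ 2) + 16 * t ^ 2) := by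
    have e1 : ∀ x, ((e x - M t i j) * u - lam * (s x * u - 4 * t)) ^ 2 =
        u ^ 2 * (e x - M t i j) ^ 2 + ((-2 * lam * u ^ 2) * ((e x - M t i j) * s x) +
        ((8 * lam * t * u) * (e x - M t i j) + (lam ^ 2 * u ^ 2 * s x ^ 2 +
        ((-8 * lam ^ 2 * u * t) * s x + lam ^ 2 * 16 * t ^ 2)))) := fun x => by ring
    simp only [e1, pathMean_add, pathMean_const_mul, hs1, law.pathMean_const]
    ring
  have hG : (∑ x : Fin (m + 1) → Fin k, ((-d j * pathWeight q (M t) x +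
      (e x - M t i j) * (pathWeight q (M t) x * s x)) * (c * u ^ 2) +
      (e x - M t i j) * pathWeight q (M t) x * (c * (-4 * t * u)))) =
      -d j * (c * u ^ 2) + c * u ^ 2 * (pathMean q (M t) fun x => (e x - M t i j) * s x) -
        c * (4 * t * u) * (pathMean q (M t) fun x => e x - M t i j) := by
    have h1 := law.pathMean_const (m := m) (-d j * (c * u ^ 2))
    rw [← h1]
    simp only [pathMean, Finset.mul_sum, ← Finset.sum_add_distrib, ← Finset.sum_sub_distrib]
    exact Finset.sum_congr rfl fun x _ => by ring
  rw [hderiv, hG, bump, ← hc, ← hu]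
  rw [hexp] at hsq
  have hfin := mul_nonneg hc0.le hsq
  have hs2' : lam ^ 2 * (c * u ^ 2) * (pathMean q (M t) fun x => s x ^ 2) ≤
      lam ^ 2 * (c * u ^ 2) * (V * F) := mul_le_mul_of_nonneg_left hs2 (by positivity)
  linarith

end OneParameter

/-! ### From coordinatewise Bayes bounds to one bad parameter -/

section ProductPrior

open MeasureTheory

/-- The probability measure on `[-r, r]` with density `bump r`. -/
noncomputable def bumpMeasure (r : ℝ) : Measure ℝ :=
  (volume.restrict (Set.Icc (-r) r)).withDensity fun t => ENNReal.ofReal (bump r t)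

theorem integral_bumpMeasure {r : ℝ} (hr : 0 < r) (f : ℝ → ℝ) :
    ∫ t, f t ∂bumpMeasure r = ∫ t in -r..r, bump r t * f t := by
  unfold bumpMeasure
  rw [integral_withDensity_eq_integral_toReal_smul
    (continuous_bump r).measurable.ennreal_ofReal (by simp),
    intervalIntegral.integral_of_le (by linarith), integral_Icc_eq_integral_Ioc]
  simp only [ENNReal.toReal_ofReal (bump_nonneg hr _), smul_eq_mul]

theorem isProbabilityMeasure_bumpMeasure {r : ℝ} (hr : 0 < r) :
    IsProbabilityMeasure (bumpMeasure r) := by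
  refine ⟨?_⟩
  unfold bumpMeasure
  rw [withDensity_apply _ MeasurableSet.univ, Measure.restrict_univ,
    ← ofReal_integral_eq_lintegral_ofReal
      ((continuous_bump r).integrableOn_Icc) (ae_of_all _ (bump_nonneg hr)),
    integral_Icc_eq_integral_Ioc, ← intervalIntegral.integral_of_le (by linarith),
    integral_bump hr, ENNReal.ofReal_one]

theorem ae_mem_bumpMeasure (r : ℝ) : ∀ᵐ t ∂bumpMeasure r, t ∈ Set.Icc (-r) r :=
  (withDensity_absolutelyContinuous _ _).ae_le (ae_restrict_mem measurableSet_Icc)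

variable {ι : Type*} [Fintype ι] [DecidableEq ι]

/-- Resampling one coordinate of a product measure leaves it unchanged. -/
theorem measurePreserving_update (ν : Measure ℝ) [IsProbabilityMeasure ν] (c : ι) :
    MeasurePreserving (fun p : (ι → ℝ) × ℝ => Function.update p.1 c p.2)
      ((Measure.pi fun _ => ν).prod ν) (Measure.pi fun _ => ν) := by
  have hm : Measurable fun p : (ι → ℝ) × ℝ => Function.update p.1 c p.2 := by
    refine measurable_pi_iff.2 fun b => ?_
    by_cases hb : b = c
    · subst hb
      simpa using measurable_snd
    · simp only [Function.update_of_ne hb]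
      fun_prop
  refine ⟨hm, (Measure.pi_eq fun s hs => ?_).symm⟩
  rw [Measure.map_apply hm (MeasurableSet.univ_pi hs)]
  have e : (fun p : (ι → ℝ) × ℝ => Function.update p.1 c p.2) ⁻¹' Set.pi Set.univ s =
      (Set.pi Set.univ (Function.update s c Set.univ)) ×ˢ s c := by
    ext p
    simp only [Set.mem_preimage, Set.mem_pi, Set.mem_univ, true_imp_iff, Set.mem_prod]
    constructor
    · refine fun h => ⟨fun b => ?_, by simpa using h c⟩
      by_cases hb : b = c
      · subst hb; simp
      · simpa [hb] using h b
    · rintro ⟨h1, h2⟩ b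
      by_cases hb : b = c
      · subst hb; simpa using h2
      · simpa [hb] using h1 b
  rw [e, Measure.prod_prod, Measure.pi_pi, ← Finset.mul_prod_erase _ _ (Finset.mem_univ c),
    ← Finset.mul_prod_erase _ (fun b => ν (s b)) (Finset.mem_univ c)]
  simp only [Function.update_self, measure_univ, one_mul]
  rw [mul_comm]
  congr 1
  refine Finset.prod_congr rfl fun b hb => ?_
  rw [Function.update_of_ne (Finset.ne_of_mem_erase hb)]

/-- If every coordinate-wise Bayes average of `R c` is at least `κ c`, then some parameter in the
box satisfies all these bounds in sum. -/
theorem exists_mem_box_sum_le {r : ℝ} (hr : 0 < r) (K : Finset ι) (R : ι → (ι → ℝ) → ℝ)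
    (hR : ∀ c, Continuous (R c)) (κ : ι → ℝ)
    (h : ∀ c ∈ K, ∀ θ : ι → ℝ, (∀ b, θ b ∈ Set.Icc (-r) r) →
      κ c ≤ ∫ t in -r..r, bump r t * R c (Function.update θ c t)) :
    ∃ θ : ι → ℝ, (∀ b, θ b ∈ Set.Icc (-r) r) ∧ ∑ c ∈ K, κ c ≤ ∑ c ∈ K, R c θ := by
  have := isProbabilityMeasure_bumpMeasure hr
  set ν := bumpMeasure r
  set P : Measure (ι → ℝ) := Measure.pi fun _ => ν
  have hbox : ∀ᵐ θ ∂P, ∀ b, θ b ∈ Set.Icc (-r) r := by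
    refine ae_all_iff.2 fun b => ?_
    exact (Measure.tendsto_eval_ae_ae (μ := fun _ : ι => ν)).eventually (ae_mem_bumpMeasure r)
  have hint : ∀ c, Integrable (R c) P := by
    intro c
    obtain ⟨C, hC⟩ := (isCompact_univ_pi fun _ : ι => isCompact_Icc (a := -r) (b := r)
      ).exists_bound_of_continuousOn (hR c).continuousOn
    refine Integrable.of_bound (hR c).aestronglyMeasurable C ?_
    filter_upwards [hbox] with θ hθ
    exact hC θ fun b _ => hθ b
  -- Resampling coordinate `c` and applying Fubini reduces the bound to the one-dimensional one,
  -- with the other coordinates frozen.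
  have hκ : ∀ c ∈ K, κ c ≤ ∫ θ, R c θ ∂P := by
    intro c hc
    have mp := measurePreserving_update ν c (ι := ι)
    have hint' : Integrable (fun p : (ι → ℝ) × ℝ => R c (Function.update p.1 c p.2))
        (P.prod ν) := mp.integrable_comp_of_integrable (hint c)
    have e : ∫ θ, R c θ ∂P = ∫ p, R c (Function.update p.1 c p.2) ∂(P.prod ν) := by
      rw [← integral_map mp.measurable.aemeasurable (hR c).aestronglyMeasurable, mp.map_eq]
    rw [e, integral_prod _ hint']
    calc κ c = ∫ _, κ c ∂P := by simp
      _ ≤ _ := by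
          refine integral_mono_ae (integrable_const _) hint'.integral_prod_left ?_
          filter_upwards [hbox] with θ hθ
          rw [integral_bumpMeasure hr]
          exact h c hc θ hθ
  -- Outside the null set of points off the box, the sum somewhere reaches at least its mean.
  obtain ⟨θ, hθ, hle⟩ := exists_notMem_null_integral_le
    (integrable_finsetSum K fun c _ => hint c) (ae_iff.1 hbox)
  refine ⟨θ, by simpa using hθ, le_trans ?_ hle⟩
  rw [integral_finsetSum _ fun c _ => hint c]
  exact Finset.sum_le_sum hκ

end ProductPrior

/-! ### Local perturbations of a chain with equal rows -/

section LocalFamily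

variable {k m : ℕ}

/-- The matrix whose rows are perturbations of `q` on the columns `T` by the centred
parameters `θ`. -/
noncomputable def tiltedRows (q : Fin k → ℝ) (T : Finset (Fin k)) (θ : Fin k × Fin k → ℝ)
    (i j : Fin k) : ℝ :=
  q j + if j ∈ T then θ (i, j) - (∑ l ∈ T, θ (i, l)) / T.card else 0

/-- The derivative of a row of `tiltedRows` in its parameter `j`. -/
noncomputable def centredIndicator (T : Finset (Fin k)) (j l : Fin k) : ℝ :=
  if l ∈ T then (if l = j then 1 else 0) - 1 / (T.card : ℝ) else 0

variable {q : Fin k → ℝ} {T : Finset (Fin k)}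

/-- Moving one parameter moves row `i` along a line, so the one-parameter bound applies with base
point at parameter value 0. -/
theorem tiltedRows_update (θ : Fin k × Fin k → ℝ) (i j : Fin k) (hj : j ∈ T) (t : ℝ) :
    tiltedRows q T (Function.update θ (i, j) t) =
      tiltRow (tiltedRows q T (Function.update θ (i, j) 0)) i (centredIndicator T j) t := by
  funext a b
  unfold tiltRow tiltedRows centredIndicator
  by_cases ha : a = i
  · subst ha
    by_cases hb : b ∈ T
    · have hsum : ∀ t : ℝ, ∑ l ∈ T, Function.update θ (a, j) t (a, l) =
          t + ∑ l ∈ T.erase j, θ (a, l) := by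
        intro t
        rw [← Finset.add_sum_erase _ _ hj, Function.update_self]
        congr 1
        refine Finset.sum_congr rfl fun l hl => Function.update_of_ne ?_ _ _
        simpa using Finset.ne_of_mem_erase hl
      rw [if_pos hb, if_pos hb, if_pos hb, hsum, hsum, if_pos rfl]
      by_cases hbj : b = j
      · subst hbj
        simp
        ring
      · have : (a, b) ≠ (a, j) := by simpa using hbj
        rw [Function.update_of_ne this, Function.update_of_ne this, if_neg hbj]
        ring
    · simp [hb]
  · have hne : ∀ l, (a, l) ≠ (i, j) := fun l h => ha (Prod.ext_iff.1 h).1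
    simp only [Function.update_of_ne (hne _), if_neg ha, mul_zero, add_zero]

theorem sum_centredIndicator {j : Fin k} (hj : j ∈ T) : ∑ l, centredIndicator T j l = 0 := by
  have hT : (T.card : ℝ) ≠ 0 := by
    have := Finset.card_pos.2 ⟨j, hj⟩
    positivity
  unfold centredIndicator
  rw [← Finset.sum_filter, Finset.filter_mem_eq_inter, Finset.univ_inter]
  simp [Finset.sum_sub_distrib, hj, hT]

/-- The vector is the projection of a basis vector orthogonal to the constants on `T`, so its
squared norm equals its own entry at `j`. -/
theorem sum_centredIndicator_sq {j : Fin k} (hj : j ∈ T) :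
    ∑ l, centredIndicator T j l ^ 2 = 1 - 1 / (T.card : ℝ) := by
  have e : ∀ l, centredIndicator T j l ^ 2 = (if l = j then centredIndicator T j l else 0) -
      1 / (T.card : ℝ) * centredIndicator T j l := by
    intro l
    unfold centredIndicator
    by_cases hlj : l = j
    · subst hlj
      simp only [if_pos hj, if_true]
      ring
    · by_cases hl : l ∈ T
      · simp only [if_pos hl, if_neg hlj]
        ring
      · simp [hl, hlj]
  simp only [e, Finset.sum_sub_distrib, ← Finset.mul_sum, sum_centredIndicator hj]
  simp [centredIndicator, hj]

theorem abs_tiltedRows_sub_le {r : ℝ} {θ : Fin k × Fin k → ℝ}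
    (hθ : ∀ c, θ c ∈ Set.Icc (-r) r) (i : Fin k) {j : Fin k} (hj : j ∈ T) :
    |tiltedRows q T θ i j - q j| ≤ 2 * r := by
  have hT : (0 : ℝ) < T.card := by exact_mod_cast Finset.card_pos.2 ⟨j, hj⟩
  have h1 : |∑ l ∈ T, θ (i, l)| ≤ T.card * r := by
    calc _ ≤ ∑ l ∈ T, |θ (i, l)| := Finset.abs_sum_le_sum_abs _ _
      _ ≤ ∑ l ∈ T, r := Finset.sum_le_sum fun l _ => abs_le.2 (hθ _)
      _ = _ := by simp
  have h2 : |(∑ l ∈ T, θ (i, l)) / T.card| ≤ r := by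
    rw [abs_div, abs_of_pos hT, div_le_iff₀ hT]
    linarith
  have h3 : |θ (i, j)| ≤ r := abs_le.2 (hθ _)
  unfold tiltedRows
  rw [if_pos hj, add_sub_cancel_left]
  calc _ ≤ |θ (i, j)| + |(∑ l ∈ T, θ (i, l)) / T.card| := abs_sub _ _
    _ ≤ _ := by linarith

theorem tiltedRows_of_notMem (θ : Fin k × Fin k → ℝ) (i : Fin k) {j : Fin k} (hj : j ∉ T) :
    tiltedRows q T θ i j = q j := by
  simp [tiltedRows, hj]

theorem sum_tiltedRows (hT : T.Nonempty) (hq : ∑ j, q j = 1) (θ : Fin k × Fin k → ℝ) (i : Fin k) :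
    ∑ j, tiltedRows q T θ i j = 1 := by
  have hc : (T.card : ℝ) ≠ 0 := by
    have := Finset.card_pos.2 hT
    positivity
  unfold tiltedRows
  rw [Finset.sum_add_distrib, hq, ← Finset.sum_filter, Finset.filter_mem_eq_inter,
    Finset.univ_inter, Finset.sum_sub_distrib, Finset.sum_const, nsmul_eq_mul,
    mul_div_cancel₀ _ hc, sub_self, add_zero]

theorem tiltedRows_mem_Icc {r : ℝ} (hr : 0 ≤ r) {θ : Fin k × Fin k → ℝ}
    (hθ : ∀ c, θ c ∈ Set.Icc (-r) r) (i j : Fin k) :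
    tiltedRows q T θ i j ∈ Set.Icc (q j - 2 * r) (q j + 2 * r) := by
  by_cases hj : j ∈ T
  · have := abs_le.1 (abs_tiltedRows_sub_le (q := q) hθ i hj)
    exact ⟨by linarith, by linarith⟩
  · rw [tiltedRows_of_notMem θ i hj]
    exact ⟨by linarith, by linarith⟩

theorem isChainLaw_tiltedRows {r : ℝ} (hr : 0 ≤ r) (hT : T.Nonempty) (hq : ∑ j, q j = 1)
    (hqr : ∀ j, 2 * r < q j) {θ : Fin k × Fin k → ℝ} (hθ : ∀ c, θ c ∈ Set.Icc (-r) r) :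
    IsChainLaw q (tiltedRows q T θ) where
  init_nonneg j := by linarith [hqr j]
  init_sum := hq
  nonneg i j := by linarith [hqr j, (tiltedRows_mem_Icc (q := q) (T := T) hr hθ i j).1]
  row_sum := sum_tiltedRows hT hq θ

theorem continuous_tiltedRows (i j : Fin k) : Continuous fun θ => tiltedRows q T θ i j := by
  unfold tiltedRows
  by_cases hj : j ∈ T
  · simp only [if_pos hj]
    fun_prop
  · simp only [if_neg hj]
    fun_prop

/-- Local minimax bound: in a box of radius `r`, some parameter makes the total squared error in
the rows `A` and the columns `T` of any estimate of the transition matrix large. -/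
theorem exists_tiltedRows_sum_pathMean_ge {r b v : ℝ} (hr : 0 < r) (hT : 2 ≤ T.card)
    (hq : ∑ j, q j = 1) (hqr : ∀ j, 2 * r < q j) (hb : ∀ l ∈ T, b ≤ q l) (hbr : 2 * r < b)
    (A : Finset (Fin k)) (hv : ∀ i ∈ A, q i + 2 * r ≤ v) (hv0 : 0 ≤ v)
    (e : (Fin (m + 1) → Fin k) → Fin k → Fin k → ℝ) :
    ∃ θ : Fin k × Fin k → ℝ, (∀ c, θ c ∈ Set.Icc (-r) r) ∧
      A.card * (((T.card : ℝ) - 1) / (m * v / (b - 2 * r) + 20 / r ^ 2)) ≤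
        ∑ i ∈ A, ∑ j ∈ T, pathMean q (tiltedRows q T θ)
          fun x => (e x i j - tiltedRows q T θ i j) ^ 2 := by
  have hTne : T.Nonempty := Finset.card_pos.1 (by omega)
  have hτ : (2 : ℝ) ≤ T.card := by exact_mod_cast hT
  set τ : ℝ := (T.card : ℝ)
  have hbr' : 0 < b - 2 * r := by linarith
  set D : ℝ := m * v / (b - 2 * r) + 20 / r ^ 2 with hD
  have hD0 : 0 < D := by positivity
  set κ : ℝ := (1 - 1 / τ) / D with hκ
  have key := exists_mem_box_sum_le hr (A ×ˢ T)
    (fun c θ => pathMean q (tiltedRows q T θ)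
      fun x : Fin (m + 1) → Fin k => (e x c.1 c.2 - tiltedRows q T θ c.1 c.2) ^ 2)
    (fun c => by
      unfold pathMean pathWeight
      refine continuous_finsetSum _ fun x _ => ?_
      exact (continuous_const.mul (continuous_finsetProd _ fun t _ =>
        continuous_tiltedRows _ _)).mul
          ((continuous_const.sub (continuous_tiltedRows _ _)).pow 2))
    (fun _ => κ) ?_
  · obtain ⟨θ, hθ, hle⟩ := key
    refine ⟨θ, hθ, ?_⟩
    rw [Finset.sum_product, Finset.sum_product] at hle
    refine le_trans (le_of_eq ?_) hle
    simp only [Finset.sum_const, nsmul_eq_mul]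
    rw [hκ]
    change _ = _ * (τ * _)
    field_simp
  · rintro ⟨i, j⟩ hij θ hθ
    obtain ⟨hi, hj⟩ := Finset.mem_product.1 hij
    simp only at hi hj
    have hbox : ∀ t ∈ Set.Icc (-r) r, ∀ c, Function.update θ (i, j) t c ∈ Set.Icc (-r) r := by
      intro t ht c
      by_cases hc : c = (i, j)
      · subst hc; simpa using ht
      · rw [Function.update_of_ne hc]; exact hθ c
    have hmem := fun t ht a b => tiltedRows_mem_Icc (q := q) (T := T) hr.le (hbox t ht) a b
    have hlaw := fun t ht => isChainLaw_tiltedRows hr.le hTne hq hqr (hbox t ht)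
    obtain ⟨B, hB⟩ : ∃ B, ∀ t, tiltedRows q T (Function.update θ (i, j) t) =
        tiltRow B i (centredIndicator T j) t := ⟨_, tiltedRows_update θ i j hj⟩
    simp only [hB] at hmem hlaw ⊢
    -- The multiplier `1 / D` is the optimal `d j / I` once the total information `I` is replaced by
    -- its bound `(1 - 1/τ) D`.
    refine le_trans ?_ (vanTrees_tiltRow (V := m * v) (F := (1 - 1 / τ) / (b - 2 * r)) hr hlaw
      (fun t ht a l => by linarith [hqr l, (hmem t ht a l).1]) (sum_centredIndicator hj)
      (by positivity)
      (fun t ht => (hlaw t ht).pathMean_visits_le (by linarith [hv i hi])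
        fun a => (hmem t ht a i).2.trans (hv i hi))
      (fun t ht => ?_) (fun x => e x i j) j (1 / D))
    · have hcj : centredIndicator T j j = 1 - 1 / τ := by simp [centredIndicator, hj, τ]
      have hτ' : 1 / 2 ≤ 1 - 1 / τ := by
        have : 1 / τ ≤ 1 / 2 := one_div_le_one_div_of_le (by norm_num) hτ
        linarith
      rw [hcj]
      -- The prior's `10 / r²` is absorbed into `(1 - 1/τ) * (20 / r²)`, as `τ ≥ 2`.
      have h1 : m * v * ((1 - 1 / τ) / (b - 2 * r)) + 10 / r ^ 2 ≤ (1 - 1 / τ) * D := by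
        have h10 : 10 / r ^ 2 = 1 / 2 * (20 / r ^ 2) := by ring
        have h20 : 0 ≤ 20 / r ^ 2 := by positivity
        rw [hD, h10, mul_add]
        refine add_le_add (le_of_eq (by ring)) (mul_le_mul_of_nonneg_right hτ' h20)
      have h2 := mul_le_mul_of_nonneg_left h1 (sq_nonneg (1 / D))
      have h3 : (1 / D) ^ 2 * ((1 - 1 / τ) * D) = κ := by rw [hκ]; field_simp
      have h4 : 2 * (1 / D) * (1 - 1 / τ) = 2 * κ := by rw [hκ]; ring
      linarith
    · rw [← sum_centredIndicator_sq hj, Finset.sum_div]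
      refine Finset.sum_le_sum fun l _ => ?_
      by_cases hl : l ∈ T
      · have := (hmem t ht i l).1
        have := hb l hl
        gcongr
        linarith
      · simp [centredIndicator, hl]

/-- The chain with initial distribution `q` and transition matrix `M`. -/
def IsChainLaw.toMarkovChain {M : Fin k → Fin k → ℝ} (h : IsChainLaw q M) : MarkovChain k where
  init := ⟨q, h.init_nonneg, h.init_sum⟩
  trans i := ⟨M i, h.nonneg i, h.row_sum i⟩

theorem IsChainLaw.stateRisk_toMarkovChain {M : Fin k → Fin k → ℝ} (h : IsChainLaw q M)
    (E : Estimator k (m + 1)) (i : Fin k) :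
    stateRisk h.toMarkovChain E i =
      ∑ j, pathMean q M fun x => (E x i j - M i j) ^ 2 := by
  rw [← pathMean_sum]
  change (pathMean q M fun x => ∑ j, (M i j - E x i j) ^ 2) = _
  congr 1
  funext x
  exact Finset.sum_congr rfl fun j _ => by ring

end LocalFamily

/-! ### Asymptotic comparison -/

section Asymptotics

/-- Truncating the excess ratio `a / b - 1` at 0 gives a single error sequence; positivity of `b`
makes the ratio meaningful. -/
theorem AsympLE.of_forall_eventually {a b : ℕ → ℝ} (hb : ∀ᶠ n in atTop, 0 < b n)
    (h : ∀ ε > 0, ∀ᶠ n in atTop, a n ≤ b n * (1 + ε)) : AsympLE a b := by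
  refine ⟨fun n => max (a n / b n - 1) 0, ?_, ?_⟩
  · rw [Metric.tendsto_nhds]
    intro ε hε
    filter_upwards [hb, h (ε / 2) (by positivity)] with n hbn hn
    have h1 : a n / b n - 1 ≤ ε / 2 := by
      rw [sub_le_iff_le_add, div_le_iff₀ hbn]
      linarith
    rw [Real.dist_0_eq_abs, abs_of_nonneg (le_max_right _ _)]
    exact (max_le h1 (by positivity)).trans_lt (by linarith)
  · filter_upwards [hb] with n hbn
    have : a n = b n * (a n / b n) := by field_simp
    calc a n = b n * (a n / b n) := this
      _ ≤ _ := by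
        refine mul_le_mul_of_nonneg_left ?_ hbn.le
        linarith [le_max_left (a n / b n - 1) 0]

theorem AsympLE.of_eventually_le {a b : ℕ → ℝ} (h : ∀ᶠ n in atTop, a n ≤ b n) : AsympLE a b :=
  ⟨fun _ => 0, tendsto_const_nhds, by simpa using h⟩

theorem AsympLE.of_eventually_le_left {a a' b : ℕ → ℝ} (h : AsympLE a b)
    (ha : ∀ᶠ n in atTop, a' n ≤ a n) : AsympLE a' b := by
  obtain ⟨e, he, hle⟩ := h
  refine ⟨e, he, ?_⟩
  filter_upwards [ha, hle] with n h1 h2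
  exact h1.trans h2

theorem tendsto_succ_mul_div_linear {a : ℝ} (ha : 0 < a) (c d : ℝ) :
    Tendsto (fun m : ℕ => ((m : ℝ) + 1) * (c / (m * a + d))) atTop (𝓝 (c / a)) := by
  have t1 : Tendsto (fun m : ℕ => 1 / (m : ℝ)) atTop (𝓝 0) :=
    tendsto_const_nhds.div_atTop tendsto_natCast_atTop_atTop
  have main : Tendsto (fun m : ℕ => (1 + 1 / (m : ℝ)) * (c / (a + d * (1 / (m : ℝ))))) atTop
      (𝓝 ((1 + 0) * (c / (a + d * 0)))) :=
    (t1.const_add 1).mul (tendsto_const_nhds.div ((t1.const_mul d).const_add a)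
      (by simpa using ha.ne'))
  simp only [add_zero, mul_zero, one_mul] at main
  refine main.congr' ?_
  filter_upwards [eventually_gt_atTop 0] with m hm
  have hm' : (m : ℝ) ≠ 0 := by positivity
  have e : (m : ℝ) * a + d = m * (a + d * (1 / (m : ℝ))) := by field_simp
  rw [e, ← div_div, div_right_comm, ← mul_div_assoc, ← mul_div_assoc,
    show (1 + 1 / (m : ℝ)) * c = ((m : ℝ) + 1) * (c / m) by field_simp]
  ring

end Asymptotics

/-! ### Bounds on risks, suprema and infima -/

section Risks

variable {k n : ℕ}

theorem stateRisk_nonneg {m : ℕ} (C : MarkovChain k) (E : Estimator k (m + 1)) (i : Fin k) :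
    0 ≤ stateRisk C E i :=
  C.isChainLaw.pathMean_nonneg fun _ => lossL2_nonneg _ _

theorem stateRisk_le_two {m : ℕ} (C : MarkovChain k) (E : Estimator k (m + 1)) (i : Fin k) :
    stateRisk C E i ≤ 2 := by
  rw [stateRisk_eq_pathMean, ← C.isChainLaw.pathMean_const (m := m) 2]
  exact C.isChainLaw.pathMean_mono fun _ => lossL2_le_two _ _

theorem maxRisk_nonneg {m : ℕ} (C : MarkovChain k) (E : Estimator k (m + 1)) :
    0 ≤ maxRisk C E :=
  Real.iSup_nonneg (stateRisk_nonneg C E)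

theorem maxRisk_le_two {m : ℕ} (C : MarkovChain k) (E : Estimator k (m + 1)) :
    maxRisk C E ≤ 2 :=
  Real.iSup_le (stateRisk_le_two C E) (by norm_num)

theorem stateRisk_le_maxRisk (C : MarkovChain k) (E : Estimator k n) (i : Fin k) :
    stateRisk C E i ≤ maxRisk C E :=
  le_ciSup (f := fun i => stateRisk C E i) (Set.finite_range _).bddAbove i

theorem weightedRisk_nonneg {m : ℕ} (hk : 0 < k) (C : MarkovChain k) (E : Estimator k (m + 1)) :
    0 ≤ weightedRisk C E :=
  Finset.sum_nonneg fun i _ => mul_nonneg ((C.stationary_spec hk).1 i) (stateRisk_nonneg C E i)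

theorem weightedRisk_le_two {m : ℕ} (hk : 0 < k) (C : MarkovChain k) (E : Estimator k (m + 1)) :
    weightedRisk C E ≤ 2 := by
  obtain ⟨h0, h1, -⟩ := C.stationary_spec hk
  calc weightedRisk C E ≤ ∑ i, C.stationary i * 2 := Finset.sum_le_sum fun i _ =>
        mul_le_mul_of_nonneg_left (stateRisk_le_two C E i) (h0 i)
    _ = 2 := by rw [← Finset.sum_mul, h1, one_mul]

variable {R : MarkovChain k → Estimator k n → ℝ} {S : Set (MarkovChain k)}

/-- Nonnegativity supplies the lower bound that a real infimum needs to be meaningful. -/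
theorem minimaxRisk_le (hR : ∀ C E, 0 ≤ R C E) (E : Estimator k n) :
    minimaxRisk R S ≤ worstCaseRisk R S E :=
  ciInf_le ⟨0, by rintro _ ⟨E, rfl⟩; exact Real.iSup_nonneg fun C => hR C E⟩ E

/-- The uniform bound `B` is essential: a real supremum over an unbounded family would be 0. -/
theorem le_minimaxRisk {B L : ℝ} (hR : ∀ C E, R C E ≤ B)
    (h : ∀ E, ∃ C ∈ S, L ≤ R C E) : L ≤ minimaxRisk R S := by
  have : Nonempty (Estimator k n) := ⟨addSqrtEstimator k n⟩
  refine le_ciInf fun E => ?_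
  obtain ⟨C, hC, hL⟩ := h E
  exact hL.trans (le_ciSup (f := fun C : S => R C E)
    ⟨B, by rintro _ ⟨C, rfl⟩; exact hR C E⟩ ⟨C, hC⟩)

end Risks

/-! ### Worst-case risks of the estimator -/

section Upper

variable {k : ℕ} {δ : ℝ}

theorem asympLE_worstCaseRisk_weightedRisk (hk : 2 ≤ k) (hδ : 0 < δ) :
    AsympLE (fun n => worstCaseRisk weightedRisk (chainsAbove k δ) (addSqrtEstimator k n))
      (fun n => ((k : ℝ) - 1) / n) := by
  have hk2 : (2 : ℝ) ≤ k := by exact_mod_cast hk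
  have hk1 : (0 : ℝ) < k - 1 := by linarith
  refine AsympLE.of_forall_eventually ?_ fun ε hε => ?_
  · filter_upwards [eventually_gt_atTop 0] with n hn
    positivity
  · filter_upwards [eventually_stationary_mul_stateRisk_le hk hδ hε] with n hn
    refine Real.iSup_le (fun C => ?_) (by positivity)
    calc weightedRisk C.1 (addSqrtEstimator k n)
        ≤ ∑ _i : Fin k, (1 - 1 / (k : ℝ)) / n * (1 + ε) :=
          Finset.sum_le_sum fun i _ => hn C.1 C.2 i
      _ = _ := by
          rw [Finset.sum_const, Finset.card_univ, Fintype.card_fin, nsmul_eq_mul]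
          field_simp

theorem asympLE_worstCaseRisk_maxRisk (hk : 2 ≤ k) (hδ : 0 < δ) :
    AsympLE (fun n => worstCaseRisk maxRisk (chainsAbove k δ) (addSqrtEstimator k n))
      (fun n => (1 - 1 / (k : ℝ)) / (n * δ)) := by
  have hk2 : (2 : ℝ) ≤ k := by exact_mod_cast hk
  have hκ : 0 < 1 - 1 / (k : ℝ) := by
    rw [sub_pos, div_lt_one (by linarith)]; linarith
  refine AsympLE.of_forall_eventually ?_ fun ε hε => ?_
  · filter_upwards [eventually_gt_atTop 0] with n hn
    positivity
  · rw [← map_add_atTop_eq_nat 1, eventually_map]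
    have ev := eventually_stationary_mul_stateRisk_le hk hδ hε
    rw [← map_add_atTop_eq_nat 1, eventually_map] at ev
    filter_upwards [ev] with m hm
    refine Real.iSup_le (fun C => Real.iSup_le (fun i => ?_) (by positivity)) (by positivity)
    have h1 : δ * stateRisk C.1 (addSqrtEstimator k (m + 1)) i ≤ _ :=
      (mul_le_mul_of_nonneg_right (C.1.le_stationary fun a => C.2 a i)
        (stateRisk_nonneg C.1 _ i)).trans (hm C.1 C.2 i)
    rw [← le_div_iff₀' hδ] at h1
    refine h1.trans_eq ?_
    rw [← div_div]
    ring

end Upper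

/-! ### Minimax lower bounds -/

section Lower

variable {k : ℕ} {δ : ℝ}

/-- All rows and columns are perturbed around the uniform chain. Every entry stays above `1/k - 2r`,
hence so does every stationary weight. -/
theorem le_minimaxRisk_weightedRisk (hk : 2 ≤ k) {r : ℝ} (hr : 0 < r) (hδ0 : 0 < δ)
    (hδ : δ ≤ 1 / (k : ℝ) - 2 * r) (m : ℕ) :
    (1 / (k : ℝ) - 2 * r) * (k * (k - 1)) /
      (m * ((1 / (k : ℝ) + 2 * r) / (1 / (k : ℝ) - 2 * r)) + 20 / r ^ 2) ≤
    minimaxRisk (n := m + 1) weightedRisk (chainsAbove k δ) := by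
  have hk0 : 0 < k := by omega
  have hk0' : (k : ℝ) ≠ 0 := by positivity
  set q : Fin k → ℝ := fun _ => 1 / (k : ℝ) with hq
  have hq1 : ∑ j, q j = 1 := by simp [hq, hk0']
  have hqr : ∀ j, 2 * r < q j := fun j => by simp only [hq]; linarith
  refine le_minimaxRisk (fun C E => weightedRisk_le_two hk0 C E) fun E => ?_
  obtain ⟨θ, hθ, hle⟩ := exists_tiltedRows_sum_pathMean_ge (m := m) (T := Finset.univ) (q := q)
    (b := 1 / (k : ℝ)) (v := 1 / (k : ℝ) + 2 * r) hr (by simpa using hk) hq1 hqr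
    (fun _ _ => le_rfl) (by linarith) Finset.univ (fun _ _ => le_rfl) (by positivity)
    (fun x i j => E x i j)
  have hne : (Finset.univ : Finset (Fin k)).Nonempty := ⟨⟨0, hk0⟩, Finset.mem_univ _⟩
  have law := isChainLaw_tiltedRows hr.le hne hq1 hqr hθ
  have hmem : ∀ i j, 1 / (k : ℝ) - 2 * r ≤ law.toMarkovChain.trans i j := fun i j =>
    (tiltedRows_mem_Icc (q := q) (T := Finset.univ) hr.le hθ i j).1
  refine ⟨law.toMarkovChain, fun i j => hδ.trans (hmem i j), ?_⟩
  calc _ = (1 / (k : ℝ) - 2 * r) * (k * ((k - 1) /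
        (m * (1 / (k : ℝ) + 2 * r) / (1 / (k : ℝ) - 2 * r) + 20 / r ^ 2))) := by ring
    _ ≤ (1 / (k : ℝ) - 2 * r) * ∑ i, stateRisk law.toMarkovChain E i := by
        refine mul_le_mul_of_nonneg_left ?_ (by linarith)
        simp only [law.stateRisk_toMarkovChain]
        simpa using hle
    _ ≤ _ := by
        rw [Finset.mul_sum]
        exact Finset.sum_le_sum fun i _ => mul_le_mul_of_nonneg_right
          (law.toMarkovChain.le_stationary fun a => hmem a i) (stateRisk_nonneg _ _ _)

/-- State `i₀` is entered with probability exactly `δ` from everywhere, so its row is observed as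
rarely as possible. The other `k - 1` columns share the remaining mass and are perturbed; the
row-sum constraint leaves `k - 2` degrees of freedom. -/
theorem le_minimaxRisk_maxRisk (hk : 3 ≤ k) {r : ℝ} (hr : 0 < r) (hδ0 : 2 * r < δ)
    (hδ : δ ≤ (1 - δ) / ((k : ℝ) - 1) - 2 * r) (m : ℕ) :
    ((k : ℝ) - 2) /
      (m * ((δ + 2 * r) / ((1 - δ) / ((k : ℝ) - 1) - 2 * r)) + 20 / r ^ 2) ≤
    minimaxRisk (n := m + 1) maxRisk (chainsAbove k δ) := by
  have hk3 : (3 : ℝ) ≤ k := by exact_mod_cast hk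
  have hk1 : (k : ℝ) - 1 ≠ 0 := by linarith
  let i₀ : Fin k := ⟨0, by omega⟩
  set T : Finset (Fin k) := Finset.univ.erase i₀ with hT
  have hTc : T.card = k - 1 := by simp [hT]
  have hTc' : (T.card : ℝ) = k - 1 := by
    rw [hTc, Nat.cast_sub (by omega)]; simp
  set q : Fin k → ℝ := fun j => if j = i₀ then δ else (1 - δ) / ((k : ℝ) - 1) with hq
  have hqT : ∀ j ∈ T, q j = (1 - δ) / ((k : ℝ) - 1) := fun j hj =>
    if_neg (Finset.ne_of_mem_erase hj)
  have hq0 : q i₀ = δ := if_pos rfl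
  have hq1 : ∑ j, q j = 1 := by
    rw [← Finset.add_sum_erase _ _ (Finset.mem_univ i₀), hq0, ← hT, Finset.sum_congr rfl hqT,
      Finset.sum_const, nsmul_eq_mul, hTc']
    field_simp
    ring
  have hqr : ∀ j, 2 * r < q j := fun j => by
    simp only [hq]
    split_ifs <;> linarith
  refine le_minimaxRisk maxRisk_le_two fun E => ?_
  obtain ⟨θ, hθ, hle⟩ := exists_tiltedRows_sum_pathMean_ge (m := m) (T := T) (q := q)
    (b := (1 - δ) / ((k : ℝ) - 1)) (v := δ + 2 * r) hr (by omega) hq1 hqr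
    (fun j hj => (hqT j hj).ge) (by linarith) {i₀} (by simp [hq0]) (by linarith)
    (fun x i j => E x i j)
  have hne : T.Nonempty := Finset.card_pos.1 (by omega)
  have law := isChainLaw_tiltedRows hr.le hne hq1 hqr hθ
  refine ⟨law.toMarkovChain, fun i j => ?_, ?_⟩
  · change δ ≤ tiltedRows q T θ i j
    by_cases hj : j ∈ T
    · have := (tiltedRows_mem_Icc (q := q) (T := T) hr.le hθ i j).1
      rw [hqT j hj] at this
      linarith
    · rw [tiltedRows_of_notMem θ i hj]
      have : j = i₀ := by simpa [hT] using hj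
      rw [this, hq0]
  · refine le_trans ?_ (stateRisk_le_maxRisk _ E i₀)
    rw [law.stateRisk_toMarkovChain]
    rw [Finset.card_singleton, Nat.cast_one, one_mul, Finset.sum_singleton, hTc'] at hle
    calc _ = ((k : ℝ) - 1 - 1) / (m * (δ + 2 * r) / ((1 - δ) / ((k : ℝ) - 1) - 2 * r) +
          20 / r ^ 2) := by ring
      _ ≤ _ := hle
      _ ≤ _ := Finset.sum_le_sum_of_subset_of_nonneg (Finset.subset_univ _) fun j _ _ =>
          law.pathMean_nonneg fun _ => sq_nonneg _

theorem eventually_le_minimaxRisk_weightedRisk (hk : 2 ≤ k) (hδ0 : 0 < δ) (hδ1 : δ < 1 / (k : ℝ))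
    {c : ℝ} (hc : c < k - 1) :
    ∀ᶠ n : ℕ in atTop, c / n ≤ minimaxRisk (n := n) weightedRisk (chainsAbove k δ) := by
  have hk0 : (0 : ℝ) < k := by positivity
  -- At `r = 0` the constant is exactly `k - 1`, so continuity provides a small radius.
  obtain ⟨r, hr, hδr, hcr⟩ : ∃ r : ℝ, 0 < r ∧ δ < 1 / (k : ℝ) - 2 * r ∧
      c < (1 / (k : ℝ) - 2 * r) * (k * (k - 1)) /
        ((1 / (k : ℝ) + 2 * r) / (1 / (k : ℝ) - 2 * r)) := by
    have t1 : ContinuousAt (fun r : ℝ => 1 / (k : ℝ) - 2 * r) 0 := by fun_prop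
    have t2 : ContinuousAt (fun r : ℝ => (1 / (k : ℝ) - 2 * r) * (k * (k - 1)) /
        ((1 / (k : ℝ) + 2 * r) / (1 / (k : ℝ) - 2 * r))) 0 := by
      refine ContinuousAt.div (by fun_prop) (ContinuousAt.div (by fun_prop) (by fun_prop) ?_) ?_
      · simp [hk0.ne']
      · simp [hk0.ne']
    have e1 := t1.eventually_const_lt (show δ < 1 / (k : ℝ) - 2 * 0 by simpa using hδ1)
    have e2 := t2.eventually_const_lt (show c < _ by
      simp only [mul_zero, sub_zero, add_zero]
      refine hc.trans_eq ?_
      field_simp)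
    obtain ⟨r, ⟨h1, h2⟩, h3⟩ := (((e1.and e2).filter_mono nhdsWithin_le_nhds).and
      (self_mem_nhdsWithin : Set.Ioi (0 : ℝ) ∈ 𝓝[>] 0)).exists
    exact ⟨r, h3, h1, h2⟩
  have hw : 0 < 1 / (k : ℝ) - 2 * r := hδ0.trans hδr
  have lim := tendsto_succ_mul_div_linear
    (a := (1 / (k : ℝ) + 2 * r) / (1 / (k : ℝ) - 2 * r)) (by positivity)
    ((1 / (k : ℝ) - 2 * r) * (k * (k - 1))) (20 / r ^ 2)
  rw [← map_add_atTop_eq_nat 1, eventually_map]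
  filter_upwards [lim.eventually_const_lt hcr] with m hm
  push_cast
  rw [div_le_iff₀' (by positivity)]
  exact hm.le.trans (mul_le_mul_of_nonneg_left
    (le_minimaxRisk_weightedRisk hk hr hδ0 hδr.le m) (by positivity))

theorem eventually_le_minimaxRisk_maxRisk (hk : 3 ≤ k) (hδ0 : 0 < δ) (hδ1 : δ < 1 / (k : ℝ))
    {c : ℝ} (hc : c < (k - 2) * ((1 - δ) / ((k : ℝ) - 1)) / δ) :
    ∀ᶠ n : ℕ in atTop, c / n ≤ minimaxRisk (n := n) maxRisk (chainsAbove k δ) := by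
  have hk3 : (3 : ℝ) ≤ k := by exact_mod_cast hk
  have hk1 : (0 : ℝ) < (k : ℝ) - 1 := by linarith
  -- This is where `δ < 1/k` enters: the perturbed columns start strictly above `δ` and have room to
  -- move.
  have hδk : δ < (1 - δ) / ((k : ℝ) - 1) := by
    rw [lt_div_iff₀ (by linarith)] at hδ1 ⊢
    linarith
  set w : ℝ := (1 - δ) / ((k : ℝ) - 1)
  have hw0 : w ≠ 0 := (hδ0.trans hδk).ne'
  obtain ⟨r, hr, hδr, hr', hcr⟩ : ∃ r : ℝ, 0 < r ∧ δ < w - 2 * r ∧ 2 * r < δ ∧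
      c < (k - 2) / ((δ + 2 * r) / (w - 2 * r)) := by
    have t1 : ContinuousAt (fun r : ℝ => w - 2 * r) 0 := by fun_prop
    have t2 : ContinuousAt (fun r : ℝ => ((k : ℝ) - 2) / ((δ + 2 * r) / (w - 2 * r))) 0 := by
      refine ContinuousAt.div (by fun_prop) (ContinuousAt.div (by fun_prop) (by fun_prop) ?_) ?_
      · simpa using hw0
      · simpa using ⟨hδ0.ne', hw0⟩
    have t3 : ContinuousAt (fun r : ℝ => 2 * r) 0 := by fun_prop
    have e1 := t1.eventually_const_lt (show δ < w - 2 * 0 by simpa using hδk)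
    have e2 := t2.eventually_const_lt (show c < _ by
      simp only [mul_zero, sub_zero, add_zero]
      refine hc.trans_eq ?_
      field_simp)
    have e3 := t3.eventually_lt_const (show 2 * (0 : ℝ) < δ by simpa using hδ0)
    obtain ⟨r, ⟨h1, h2, h4⟩, h3⟩ := (((e1.and (e2.and e3)).filter_mono nhdsWithin_le_nhds).and
      (self_mem_nhdsWithin : Set.Ioi (0 : ℝ) ∈ 𝓝[>] 0)).exists
    exact ⟨r, h3, h1, h4, h2⟩
  have hw : 0 < w - 2 * r := hδ0.trans hδr
  have lim := tendsto_succ_mul_div_linear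
    (a := (δ + 2 * r) / (w - 2 * r)) (by positivity) ((k : ℝ) - 2) (20 / r ^ 2)
  rw [← map_add_atTop_eq_nat 1, eventually_map]
  filter_upwards [lim.eventually_const_lt hcr] with m hm
  push_cast
  rw [div_le_iff₀' (by positivity)]
  exact hm.le.trans (mul_le_mul_of_nonneg_left
    (le_minimaxRisk_maxRisk hk hr hr' hδr.le m) (by positivity))

theorem asympLE_minimaxRisk_weightedRisk (hk : 2 ≤ k) (hδ0 : 0 < δ) (hδ1 : δ < 1 / (k : ℝ)) :
    AsympLE (fun n => ((k : ℝ) - 1) / n)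
      (fun n => minimaxRisk (n := n) weightedRisk (chainsAbove k δ)) := by
  have hk2 : (2 : ℝ) ≤ k := by exact_mod_cast hk
  have hk1 : (0 : ℝ) < k - 1 := by linarith
  refine AsympLE.of_forall_eventually ?_ fun ε hε => ?_
  · filter_upwards [eventually_gt_atTop 0, eventually_le_minimaxRisk_weightedRisk hk hδ0 hδ1
      (c := (k - 1) / 2) (by linarith)] with n hn hle
    exact lt_of_lt_of_le (by positivity) hle
  · filter_upwards [eventually_le_minimaxRisk_weightedRisk hk hδ0 hδ1
      (c := (k - 1) / (1 + ε)) (div_lt_self hk1 (by linarith))] with n hle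
    rw [← div_le_iff₀ (by positivity)]
    rwa [div_right_comm]

theorem asympLE_minimaxRisk_maxRisk (hk : 2 ≤ k) (hδ0 : 0 < δ) (hδ1 : δ < 1 / (k : ℝ)) :
    AsympLE (fun n => (1 - δ) ^ 2 * ((1 - 1 / ((k : ℝ) - 1)) / (n * δ)))
      (fun n => minimaxRisk (n := n) maxRisk (chainsAbove k δ)) := by
  refine AsympLE.of_eventually_le ?_
  -- For `k = 2` no column is left to perturb, but the claimed bound is then 0.
  rcases hk.eq_or_lt with rfl | hk3
  · rw [← map_add_atTop_eq_nat 1, eventually_map]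
    refine Eventually.of_forall fun m => ?_
    have : (1 : ℝ) - 1 / (((2 : ℕ) : ℝ) - 1) = 0 := by norm_num
    rw [this, zero_div, mul_zero]
    exact Real.iInf_nonneg fun E => Real.iSup_nonneg fun C => maxRisk_nonneg _ E
  · have hk3' : (3 : ℝ) ≤ k := by exact_mod_cast hk3
    have hk1 : (0 : ℝ) < (k : ℝ) - 1 := by linarith
    have hk2 : (0 : ℝ) < (k : ℝ) - 2 := by linarith
    have hδ1' : 0 < 1 - δ := by
      have : 1 / (k : ℝ) < 1 := by rw [div_lt_one (by linarith)]; linarith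
      linarith
    -- The construction yields the factor `1 - δ`, strictly better than `(1 - δ) ^ 2`; this slack is
    -- why no error term is needed here.
    have hc : (1 - δ) ^ 2 * (1 - 1 / ((k : ℝ) - 1)) / δ <
        (k - 2) * ((1 - δ) / ((k : ℝ) - 1)) / δ := by
      have e : 1 - 1 / ((k : ℝ) - 1) = (k - 2) / (k - 1) := by field_simp; ring
      have h2 : (1 - δ) ^ 2 < 1 - δ := by nlinarith
      calc _ = (1 - δ) ^ 2 * ((k - 2) / ((k : ℝ) - 1) / δ) := by rw [e]; ring
        _ < (1 - δ) * ((k - 2) / ((k : ℝ) - 1) / δ) :=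
            mul_lt_mul_of_pos_right h2 (by positivity)
        _ = _ := by ring
    filter_upwards [eventually_le_minimaxRisk_maxRisk hk3 hδ0 hδ1 hc] with n hn
    refine le_trans (le_of_eq ?_) hn
    rw [mul_comm (n : ℝ) δ, ← div_div]
    ring

end Lower

theorem theorem4 (k : ℕ) (hk : 2 ≤ k) (δ : ℝ) (hδ0 : 0 < δ) (hδ1 : δ < 1 / (k : ℝ)) :
    -- the stationary-weighted minimax risk
    AsympEq (fun n => minimaxRisk (n := n) weightedRisk (chainsAbove k δ))
      (fun n => ((k : ℝ) - 1) / n) ∧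
    -- the worst-state minimax risk
    AsympLE (fun n => (1 - δ) ^ 2 * ((1 - 1 / ((k : ℝ) - 1)) / (n * δ)))
      (fun n => minimaxRisk (n := n) maxRisk (chainsAbove k δ)) ∧
    AsympLE (fun n => minimaxRisk (n := n) maxRisk (chainsAbove k δ))
      (fun n => (1 - 1 / (k : ℝ)) / (n * δ)) ∧
    -- both upper bounds are met by the add-`√N_i / k` estimator
    AsympLE (fun n => worstCaseRisk weightedRisk (chainsAbove k δ) (addSqrtEstimator k n))
      (fun n => ((k : ℝ) - 1) / n) ∧
    AsympLE (fun n => worstCaseRisk maxRisk (chainsAbove k δ) (addSqrtEstimator k n))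
      (fun n => (1 - 1 / (k : ℝ)) / (n * δ)) := by
  have hle : ∀ᶠ n : ℕ in atTop, minimaxRisk (n := n) weightedRisk (chainsAbove k δ) ≤
      worstCaseRisk weightedRisk (chainsAbove k δ) (addSqrtEstimator k n) := by
    rw [← map_add_atTop_eq_nat 1, eventually_map]
    exact Eventually.of_forall fun m =>
      minimaxRisk_le (weightedRisk_nonneg (by omega)) (addSqrtEstimator k (m + 1))
  have hle' : ∀ᶠ n : ℕ in atTop, minimaxRisk (n := n) maxRisk (chainsAbove k δ) ≤
      worstCaseRisk maxRisk (chainsAbove k δ) (addSqrtEstimator k n) := by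
    rw [← map_add_atTop_eq_nat 1, eventually_map]
    exact Eventually.of_forall fun m =>
      minimaxRisk_le maxRisk_nonneg (addSqrtEstimator k (m + 1))
  exact ⟨⟨(asympLE_worstCaseRisk_weightedRisk hk hδ0).of_eventually_le_left hle,
      asympLE_minimaxRisk_weightedRisk hk hδ0 hδ1⟩,
    asympLE_minimaxRisk_maxRisk hk hδ0 hδ1,
    (asympLE_worstCaseRisk_maxRisk hk hδ0).of_eventually_le_left hle',
    asympLE_worstCaseRisk_weightedRisk hk hδ0, asympLE_worstCaseRisk_maxRisk hk hδ0⟩
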